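/- Let $X$ be a proper geodesic metric space and let $G$ be a group acting freely and properly discontinuously by isometries on $X$. Assume one of the following. Case 1: $X$ is CAT$(-1)$, and $\partial X$ is the horofunction boundary, i.e. $\overline{i(X)}\setminus i(X)$, where $i(z)$ is the class of $d(z,\cdot)$ modulo constants and the closure is taken for uniform convergence on compact sets. Case 2: $X$ is Gromov-hyperbolic, and $\partial X$ is the Gromov boundary, i.e. the quotient of the horofunction boundary obtained by identifying functions that differ by a bounded function. Fix $o\in X$. Let $\Lambda\subset\partial X$ be the limit set of $G$ (the set of accumulation points of $G\cdot o$ in $\partial X$) and assume that $\Lambda$ is infinite. For $\xi\in\partial X$ put $\beta_\xi(p,q)=\limsup_{z\to\xi}\,(d(p,z)-d(q,z))$. Let $v\ge 0$ and let $x\mapsto\mu_x$ be a conformal or quasiconformal density of dimension $v$ on $\Lambda$: finite Borel measures carried by $\Lambda$ with $\mu_{gx}=g_*\mu_x$ and, for some $C\ge 1$ ($C=1$ in the conformal case) and all $x,y\in X$, $$C^{-1}e^{v\beta_\xi(y,x)}\le\frac{d\mu_x}{d\mu_y}(\xi)\le C\,e^{v\beta_\xi(y,x)}\quad\text{for a.e.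 }\xi ;$$ for instance a Patterson--Sullivan density. Normalize $\mu=\mu_o$ to be a probability measure. Put $B_r=\{g\in G: d(o,g o)\le r\}$ and $$C_r=e^{-vr}\int_\Lambda\max_{g\in B_r}\frac{d\mu_{g o}}{d\mu_o}\,d\mu ,\qquad f_r(x)=\exp(-v\,d(x,B_r\cdot o))\quad(x\in X).$$ Let $\Sigma_r(o)$ be the sphere of radius $r$ about $o$, and let $\pi_r:\Lambda\to\Sigma_r(o)$ send $\xi$ to the point at distance $r$ from $o$ on a geodesic ray $[o,\xi)$ (any choice of rays in Case 2; if the resulting function is not measurable, its integral is the lower integral). Let $\mu_r$ be averaging measures with respect to $\mu$: probability measures on $\Sigma_r(o)$, indexed by an unbounded set of radii $r\ge 0$ (such as $[0,\infty)$ or $\mathbb N$), such that there is $D\ge 1$ for which every weak limit on $X\cup\partial X$ of $\mu_{r_n}$, $r_n\to\infty$, is carried by $\Lambda$ and has density in $[1/D,D]$ with respect to $\mu$, and such that for $r>t$: * in Case 1, $(\pi_{rt})_*\mu_r=\mu_t$, where $\pi_{rt}(x)$ is the point of $[o,x]$ at distance $t$ from $o$; * in Case 2, where averaging measures are considered only when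 $X$ is a uniformly proper graph with all edges of length one, $\frac1D\le\frac{d(\pi_{rt})_*\mu_r}{d\mu_t}\le D$, where $\pi_{rt}$ sends the Dirac mass at $x\in\Sigma_r(o)$ to the uniform distribution on the set of points of $\Sigma_t(o)$ lying on geodesics from $o$ to $x$. Then there are constants $K\ge1$ and $R_0$ such that for all $r\ge R_0$ and all choices of $\pi_r$, $$\frac1K\int_\Lambda f_r(\pi_r(\xi))\,d\mu(\xi)\le C_r\le K\int_\Lambda f_r(\pi_r(\xi))\,d\mu(\xi),$$ $$\frac1K\int_{\Sigma_r(o)} f_r\,d\mu_r\le \int_\Lambda f_r(\pi_r(\xi))\,d\mu(\xi)\le K\int_{\Sigma_r(o)} f_r\,d\mu_r ,$$ the second line for $r$ in the index set of the family $\{\mu_r\}$. In Case 2 the first line holds for every proper geodesic Gromov-hyperbolic $X$, not only for graphs. -/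

import Mathlib

open MeasureTheory Filter Topology Set
open scoped ENNReal NNReal BoundedContinuousFunction

noncomputable section

namespace ECG

/-! ### Geodesic, hyperbolic and CAT(-1) spaces -/

/-- Any two points are joined by a geodesic segment. -/
def IsGeodesicSpace (X : Type*) [MetricSpace X] : Prop :=
  ∀ x y : X, ∃ γ : ℝ → X, γ 0 = x ∧ γ (dist x y) = y ∧
    ∀ s ∈ Icc 0 (dist x y), ∀ t ∈ Icc 0 (dist x y), dist (γ s) (γ t) = |s - t|

/-- The Gromov product `(x|y)_w`. -/
def gromovProd {X : Type*} [MetricSpace X] (w x y : X) : ℝ :=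
  (dist x w + dist y w - dist x y) / 2

/-- Gromov hyperbolicity: the four point condition for some `δ`. -/
def IsGromovHyperbolic (X : Type*) [MetricSpace X] : Prop :=
  ∃ δ : ℝ, ∀ w x y z : X,
    min (gromovProd w x y) (gromovProd w y z) - δ ≤ gromovProd w x z

/-- CAT(-1) spaces: geodesic triangles are at least as thin as their comparison triangles in the
hyperbolic plane. Here `x` is a point of a side `[p, q]` and `y` a point of a side `[p, r]`
(in a geodesic space, `x` lies on a geodesic from `p` to `q` iff
`dist p x + dist x q = dist p q`), and primes denote comparison points. -/
def IsCATNegOne (X : Type*) [MetricSpace X] : Prop :=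
  IsGeodesicSpace X ∧
  ∀ (p q r x y : X) (p' q' r' x' y' : UpperHalfPlane),
    dist p x + dist x q = dist p q → dist p y + dist y r = dist p r →
    dist p' q' = dist p q → dist p' r' = dist p r → dist q' r' = dist q r →
    dist p' x' = dist p x → dist x' q' = dist x q →
    dist p' y' = dist p y → dist y' r' = dist y r →
    dist x y ≤ dist x' y'

/-- `γ` restricted to `[0, ∞)` is a geodesic ray issuing from `o`. -/
def IsGeodesicRay {X : Type*} [MetricSpace X] (o : X) (γ : ℝ → X) : Prop :=
  γ 0 = o ∧ ∀ s t : ℝ, 0 ≤ s → 0 ≤ t → dist (γ s) (γ t) = |s - t|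

/-- `X` is (the geometric realization of) the connected graph `Γ`, with vertex set `V ⊆ X` and
with all edges of length one. The point `x` lies on the edge `{u, v}` iff
`dist u x + dist x v = 1`. -/
structure IsUnitGraph (X : Type*) [MetricSpace X] (V : Set X) (Γ : SimpleGraph V) : Prop where
  connected : Γ.Connected
  dist_vertex : ∀ u v : V, dist (u : X) (v : X) = Γ.dist u v
  exists_edge : ∀ x : X, ∃ u v : V, Γ.Adj u v ∧ dist (u : X) x + dist x (v : X) = 1
  dist_same_edge : ∀ (u v : V) (x y : X), Γ.Adj u v →
    dist (u : X) x + dist x (v : X) = 1 → dist (u : X) y + dist y (v : X) = 1 →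
    dist x y = |dist (u : X) x - dist (u : X) y|
  dist_other_edge : ∀ (u v u' v' : V) (x y : X), Γ.Adj u v → Γ.Adj u' v' →
    s(u, v) ≠ s(u', v') →
    dist (u : X) x + dist x (v : X) = 1 → dist (u' : X) y + dist y (v' : X) = 1 →
    ∃ a b : V, (a = u ∨ a = v) ∧ (b = u' ∨ b = v') ∧
      dist x y = dist x (a : X) + dist (a : X) (b : X) + dist (b : X) y

/-- `X` is a uniformly proper graph with edges of length one: the number of vertices in a ball is
bounded in terms of its radius only. -/
def IsUniformlyProperUnitGraph (X : Type*) [MetricSpace X] : Prop :=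
  ∃ (V : Set X) (Γ : SimpleGraph V), IsUnitGraph X V Γ ∧
    ∀ R : ℝ, ∃ N : ℕ, ∀ x : X, (V ∩ Metric.closedBall x R).encard ≤ N

/-! ### The horofunction compactification -/

/-- The class of `dist z ·` modulo constants, recorded as the difference cocycle
`(p, q) ↦ dist p z - dist q z`. -/
def distCocycle {X : Type*} [MetricSpace X] (z : X) : X → X → ℝ :=
  fun p q => dist p z - dist q z

/-- The horofunction compactification: the closure of `X` in the space of 1-Lipschitz functions
modulo constants, a class `[f]` being recorded as `(p, q) ↦ f p - f q`. For 1-Lipschitz functions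
uniform convergence on compact sets is the same as pointwise convergence. -/
def HoroBord (X : Type*) [MetricSpace X] : Type _ :=
  {h : X → X → ℝ // h ∈ closure (range (distCocycle (X := X)))}

instance (X : Type*) [MetricSpace X] : TopologicalSpace (HoroBord X) :=
  inferInstanceAs
    (TopologicalSpace {h : X → X → ℝ // h ∈ closure (range (distCocycle (X := X)))})

instance (X : Type*) [MetricSpace X] : MeasurableSpace (HoroBord X) := borel _

instance (X : Type*) [MetricSpace X] : BorelSpace (HoroBord X) := ⟨rfl⟩

/-- The embedding of `X` in its horofunction compactification. -/
def HoroBord.incl {X : Type*} [MetricSpace X] (z : X) : HoroBord X :=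
  ⟨distCocycle z, subset_closure (mem_range_self z)⟩

/-- The action of isometries on the horofunction compactification. -/
def HoroBord.act {X G : Type*} [MetricSpace X] [Group G] [MulAction G X] [IsIsometricSMul G X]
    (g : G) (h : HoroBord X) : HoroBord X :=
  ⟨fun p q => h.1 (g⁻¹ • p) (g⁻¹ • q), by
    have hc : Continuous (fun (f : X → X → ℝ) (p q : X) => f (g⁻¹ • p) (g⁻¹ • q)) := by
      fun_prop
    refine map_mem_closure hc h.2 ?_
    rintro _ ⟨z, rfl⟩
    refine ⟨g • z, ?_⟩
    funext p q
    have key : ∀ p : X, dist (g⁻¹ • p) z = dist p (g • z) := fun p => by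
      rw [← dist_smul g (g⁻¹ • p) z, smul_inv_smul]
    simp only [distCocycle, key]⟩

theorem HoroBord.act_incl {X G : Type*} [MetricSpace X] [Group G] [MulAction G X]
    [IsIsometricSMul G X] (g : G) (z : X) :
    HoroBord.act g (HoroBord.incl z) = HoroBord.incl (g • z) := by
  apply Subtype.ext
  funext p q
  have key : ∀ p : X, dist (g⁻¹ • p) z = dist p (g • z) := fun p => by
    rw [← dist_smul g (g⁻¹ • p) z, smul_inv_smul]
  simp only [HoroBord.act, HoroBord.incl, distCocycle, key]

theorem HoroBord.act_inv_act {X G : Type*} [MetricSpace X] [Group G] [MulAction G X]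
    [IsIsometricSMul G X] (g : G) (h : HoroBord X) :
    HoroBord.act g⁻¹ (HoroBord.act g h) = h := by
  apply Subtype.ext
  funext p q
  simp [HoroBord.act]

theorem HoroBord.act_notMem_range {X G : Type*} [MetricSpace X] [Group G] [MulAction G X]
    [IsIsometricSMul G X] (g : G) {h : HoroBord X} (hh : h ∉ range (HoroBord.incl (X := X))) :
    HoroBord.act g h ∉ range (HoroBord.incl (X := X)) := by
  rintro ⟨z, hz⟩
  apply hh
  refine ⟨g⁻¹ • z, ?_⟩
  rw [← HoroBord.act_incl, hz, HoroBord.act_inv_act]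

/-! ### The Gromov compactification -/

/-- Two points of the horofunction boundary are identified when they differ by a bounded
function; points of `X` are not identified with anything else. -/
def gromovSetoid (X : Type*) [MetricSpace X] : Setoid (HoroBord X) where
  r a b := a = b ∨ (a ∉ range (HoroBord.incl (X := X)) ∧ b ∉ range (HoroBord.incl (X := X)) ∧
    ∃ C : ℝ, ∀ p q : X, |a.1 p q - b.1 p q| ≤ C)
  iseqv :=
    { refl := fun _ => Or.inl rfl
      symm := by
        rintro a b (h | ⟨ha, hb, C, hC⟩)
        · exact Or.inl h.symm
        · exact Or.inr ⟨hb, ha, C, fun p q => by rw [abs_sub_comm]; exact hC p q⟩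
      trans := by
        rintro a b c (rfl | ⟨ha, hb, C, hC⟩) (rfl | ⟨hb', hc, D, hD⟩)
        · exact Or.inl rfl
        · exact Or.inr ⟨hb', hc, D, hD⟩
        · exact Or.inr ⟨ha, hb, C, hC⟩
        · exact Or.inr ⟨ha, hc, C + D, fun p q =>
            (abs_sub_le _ (b.1 p q) _).trans (add_le_add (hC p q) (hD p q))⟩ }

/-- The Gromov compactification `X ∪ ∂X`, with the quotient topology. -/
def GromovBord (X : Type*) [MetricSpace X] : Type _ := Quotient (gromovSetoid X)

instance (X : Type*) [MetricSpace X] : TopologicalSpace (GromovBord X) :=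
  inferInstanceAs (TopologicalSpace (Quotient (gromovSetoid X)))

instance (X : Type*) [MetricSpace X] : MeasurableSpace (GromovBord X) := borel _

instance (X : Type*) [MetricSpace X] : BorelSpace (GromovBord X) := ⟨rfl⟩

/-- The embedding of `X` in its Gromov compactification. -/
def GromovBord.incl {X : Type*} [MetricSpace X] (z : X) : GromovBord X :=
  Quotient.mk (gromovSetoid X) (HoroBord.incl z)

/-- The action of isometries on the Gromov compactification. -/
def GromovBord.act {X G : Type*} [MetricSpace X] [Group G] [MulAction G X] [IsIsometricSMul G X]
    (g : G) : GromovBord X → GromovBord X :=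
  Quotient.map (HoroBord.act g) (by
    rintro a b (rfl | ⟨ha, hb, C, hC⟩)
    · exact Or.inl rfl
    · exact Or.inr ⟨HoroBord.act_notMem_range g ha, HoroBord.act_notMem_range g hb, C,
        fun p q => hC _ _⟩)

/-! ### Limit sets, Busemann functions, densities

Below `B` is a compactification of `X` (the horofunction or the Gromov compactification),
`incl : X → B` the inclusion and `act` the action of `G` on `B`. The boundary is the complement of
the range of `incl`; measures on the boundary are regarded as measures on `B`. -/

/-- The limit set: the accumulation points in the boundary of the orbit `G • o`. -/
def limitSet (G : Type*) {X B : Type*} [MetricSpace X] [Group G] [MulAction G X]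
    [TopologicalSpace B] (incl : X → B) (o : X) : Set B :=
  closure (range fun g : G => incl (g • o)) \ range incl

/-- The Busemann function `β_ξ(p, q) = limsup_{z → ξ} (d(p, z) - d(q, z))`, with `z ∈ X`. -/
def busemann {X B : Type*} [MetricSpace X] [TopologicalSpace B] (incl : X → B)
    (ξ : B) (p q : X) : ℝ :=
  limsup (fun z : X => dist p z - dist q z) (comap incl (𝓝 ξ))

/-- `C⁻¹ f ≤ dν/dμ ≤ C f`, almost everywhere. -/
def DensityBounds {S : Type*} [MeasurableSpace S] (ν μ : Measure S) (C : ℝ) (f : S → ℝ) : Prop :=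
  ν ≪ μ ∧ ∀ᵐ ξ ∂μ, ENNReal.ofReal (C⁻¹ * f ξ) ≤ ν.rnDeriv μ ξ ∧
    ν.rnDeriv μ ξ ≤ ENNReal.ofReal (C * f ξ)

/-- `x ↦ μ x` is a `G`-invariant `C`-quasiconformal density of dimension `v` carried by `Λ`.
For `C = 1` this is a conformal density. -/
structure IsQuasiconformalDensity {G X B : Type*} [MetricSpace X] [Group G] [MulAction G X]
    [TopologicalSpace B] [MeasurableSpace B] (incl : X → B) (act : G → B → B)
    (Λ : Set B) (v C : ℝ) (μ : X → Measure B) : Prop where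
  finite : ∀ x, IsFiniteMeasure (μ x)
  carried : ∀ x, μ x Λᶜ = 0
  equivariant : ∀ (g : G) (x : X), μ (g • x) = (μ x).map (act g)
  density : ∀ x y : X,
    DensityBounds (μ x) (μ y) C (fun ξ => Real.exp (v * busemann incl ξ y x))

/-! ### The normalized extremal cocycle -/

/-- `B_r = {g ∈ G | g • o ∈ B(o, r)}`. -/
def orbitBall (G : Type*) {X : Type*} [MetricSpace X] [Group G] [MulAction G X] (o : X) (r : ℝ) :
    Set G :=
  {g | dist o (g • o) ≤ r}

/-- `A_r(ξ) = max_{g ∈ B_r} (dμ_{g • o} / dμ_o)(ξ)`. -/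
def maxDeriv (G : Type*) {X B : Type*} [MetricSpace X] [Group G] [MulAction G X]
    [MeasurableSpace B] (μ : X → Measure B) (o : X) (r : ℝ) (ξ : B) : ℝ≥0∞ :=
  ⨆ g ∈ orbitBall G o r, (μ (g • o)).rnDeriv (μ o) ξ

/-- `C_r = exp (-v r) ∫_Λ A_r dμ_o`. -/
def extremalCocycle (G : Type*) {X B : Type*} [MetricSpace X] [Group G] [MulAction G X]
    [MeasurableSpace B] (Λ : Set B) (v : ℝ) (μ : X → Measure B) (o : X) (r : ℝ) : ℝ≥0∞ :=
  (∫⁻ ξ in Λ, maxDeriv G μ o r ξ ∂(μ o)) / ENNReal.ofReal (Real.exp (v * r))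

/-- `exp (-v d(x, B_r • o))`. -/
def expDist (G : Type*) {X : Type*} [MetricSpace X] [Group G] [MulAction G X]
    (v : ℝ) (o : X) (r : ℝ) (x : X) : ℝ≥0∞ :=
  ENNReal.ofReal (Real.exp (-v * Metric.infDist x ((fun g : G => g • o) '' orbitBall G o r)))

/-- `π` is a projection `π_r : Λ → Σ_r(o)`: it sends `ξ ∈ Λ` to the point at distance `r` from `o`
on a geodesic ray `[o, ξ)`. -/
def IsBoundaryProj {X B : Type*} [MetricSpace X] [TopologicalSpace B] (incl : X → B)
    (Λ : Set B) (o : X) (r : ℝ) (π : B → X) : Prop :=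
  ∀ ξ ∈ Λ, ∃ γ : ℝ → X, IsGeodesicRay o γ ∧ Tendsto (fun t => incl (γ t)) atTop (𝓝 ξ) ∧
    π ξ = γ r

/-! ### Averaging measures -/

/-- The points of `Σ_t(o)` that lie on a geodesic from `o` to `x`. -/
def radialPoints {X : Type*} [MetricSpace X] (o : X) (t : ℝ) (x : X) : Set X :=
  {y | dist o y = t ∧ dist o y + dist y x = dist o x}

open Classical in
/-- A point of `radialPoints o t x` (the unique one, if geodesics in `X` are unique), and `o` if
there is none. -/
def radialProj {X : Type*} [MetricSpace X] (o : X) (t : ℝ) (x : X) : X :=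
  if h : (radialPoints o t x).Nonempty then h.some else o

/-- The coarse projection of a measure to `Σ_t(o)`: the linear extension of the rule that sends
the Dirac mass at `x` to the uniform distribution on `radialPoints o t x`. -/
def coarsePush {X : Type*} [MetricSpace X] [MeasurableSpace X] (o : X) (t : ℝ) (ν : Measure X) :
    Measure X :=
  ν.bind fun x => ProbabilityTheory.uniformOn (radialPoints o t x)

/-- `m r`, for `r ∈ I`, are probability measures on the spheres `Σ_r(o)`. -/
def AreSphereMeasures {X : Type*} [MetricSpace X] [MeasurableSpace X] (o : X) (I : Set ℝ)
    (m : ℝ → Measure X) : Prop :=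
  ∀ r ∈ I, IsProbabilityMeasure (m r) ∧ m r (Metric.sphere o r)ᶜ = 0

/-- `ν` is a weak limit on `B` of `m (r n)` for a sequence `r n → ∞` in `I`. -/
def IsWeakLimit {X B : Type*} [MetricSpace X] [MeasurableSpace X] [TopologicalSpace B]
    [MeasurableSpace B] (incl : X → B) (I : Set ℝ) (m : ℝ → Measure X) (ν : Measure B) : Prop :=
  ∃ r : ℕ → ℝ, (∀ n, r n ∈ I) ∧ Tendsto r atTop atTop ∧
    ∀ f : B →ᵇ ℝ, Tendsto (fun n => ∫ x, f (incl x) ∂(m (r n))) atTop (𝓝 (∫ ξ, f ξ ∂ν))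

/-- All weak limits of `m r` as `r → ∞` are carried by `Λ` and have a density with respect to `μ`
between `1/D` and `D`. -/
def WeakLimitsComparable {X B : Type*} [MetricSpace X] [MeasurableSpace X] [TopologicalSpace B]
    [MeasurableSpace B] (incl : X → B) (Λ : Set B) (μ : Measure B) (I : Set ℝ)
    (m : ℝ → Measure X) (D : ℝ) : Prop :=
  ∀ ν : Measure B, IsFiniteMeasure ν → IsWeakLimit incl I m ν →
    ν Λᶜ = 0 ∧ DensityBounds ν μ D (fun _ => 1)

/-- Averaging measures on the spheres of a space with unique geodesics. -/
def IsAveraging {X B : Type*} [MetricSpace X] [MeasurableSpace X] [TopologicalSpace B]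
    [MeasurableSpace B] (incl : X → B) (Λ : Set B) (μ : Measure B) (o : X) (I : Set ℝ)
    (m : ℝ → Measure X) : Prop :=
  AreSphereMeasures o I m ∧
  (∀ r ∈ I, ∀ t ∈ I, t < r → (m r).map (radialProj o t) = m t) ∧
  ∃ D : ℝ, 1 ≤ D ∧ WeakLimitsComparable incl Λ μ I m D

/-- Averaging measures on the spheres of a graph. -/
def IsCoarselyAveraging {X B : Type*} [MetricSpace X] [MeasurableSpace X] [TopologicalSpace B]
    [MeasurableSpace B] (incl : X → B) (Λ : Set B) (μ : Measure B) (o : X) (I : Set ℝ)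
    (m : ℝ → Measure X) : Prop :=
  AreSphereMeasures o I m ∧
  ∃ D : ℝ, 1 ≤ D ∧
    (∀ r ∈ I, ∀ t ∈ I, t < r → DensityBounds (coarsePush o t (m r)) (m t) D (fun _ => 1)) ∧
    WeakLimitsComparable incl Λ μ I m D

/-- `a` and `b` agree up to the multiplicative constant `K`. -/
def Comparable (K : ℝ≥0) (a b : ℝ≥0∞) : Prop := a ≤ K * b ∧ b ≤ K * a

end ECG

end

noncomputable section

namespace ECG

/-! ### CAT(-1) spaces are Gromov hyperbolic -/

theorem cosh_sub_sinh_mul_pos (a : ℝ) {c s : ℝ} (h : c ^ 2 + s ^ 2 = 1) :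
    0 < Real.cosh a - Real.sinh a * c := by
  have h1 := Real.cosh_sq a
  have h2 := Real.cosh_pos a
  by_contra! h3
  nlinarith [sq_nonneg (Real.sinh a * s), sq_nonneg (Real.sinh a)]

/-- The point of the upper half plane at distance `a` from `i` in the direction with cosine `c`
and sine `s`. -/
def polarPoint (a c s : ℝ) (h : c ^ 2 + s ^ 2 = 1) : UpperHalfPlane :=
  ⟨⟨Real.sinh a * s / (Real.cosh a - Real.sinh a * c), 1 / (Real.cosh a - Real.sinh a * c)⟩,
    one_div_pos.2 (cosh_sub_sinh_mul_pos a h)⟩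

theorem cosh_dist_polarPoint (a b : ℝ) {c s c' s' : ℝ} (h : c ^ 2 + s ^ 2 = 1)
    (h' : c' ^ 2 + s' ^ 2 = 1) :
    Real.cosh (dist (polarPoint a c s h) (polarPoint b c' s' h')) =
      Real.cosh a * Real.cosh b - Real.sinh a * Real.sinh b * (c * c' + s * s') := by
  rw [UpperHalfPlane.cosh_dist']
  have hu := cosh_sub_sinh_mul_pos a h
  have hw := cosh_sub_sinh_mul_pos b h'
  have ha := Real.cosh_sq a
  have hb := Real.cosh_sq b
  change ((Real.sinh a * s / (Real.cosh a - Real.sinh a * c) -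
      Real.sinh b * s' / (Real.cosh b - Real.sinh b * c')) ^ 2 +
      (1 / (Real.cosh a - Real.sinh a * c)) ^ 2 + (1 / (Real.cosh b - Real.sinh b * c')) ^ 2) /
      (2 * (1 / (Real.cosh a - Real.sinh a * c)) * (1 / (Real.cosh b - Real.sinh b * c'))) = _
  generalize Real.cosh a = A at *
  generalize Real.cosh b = B at *
  generalize Real.sinh a = P at *
  generalize Real.sinh b = Q at *
  have e1 : 1 = A ^ 2 - P ^ 2 * (c ^ 2 + s ^ 2) := by rw [h]; linarith
  have e2 : 1 = B ^ 2 - Q ^ 2 * (c' ^ 2 + s' ^ 2) := by rw [h']; linarith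
  field_simp
  linear_combination (B - Q * c') ^ 2 * e1 + (A - P * c) ^ 2 * e2

theorem dist_eq_of_cosh_dist_eq {x y : UpperHalfPlane} {a : ℝ} (ha : 0 ≤ a)
    (h : Real.cosh (dist x y) = Real.cosh a) : dist x y = a :=
  Real.cosh_strictMonoOn.injOn (mem_Ici.2 dist_nonneg) (mem_Ici.2 ha) h

theorem dist_polarPoint_same {a b : ℝ} (hab : a ≤ b) {c s : ℝ} (h : c ^ 2 + s ^ 2 = 1) :
    dist (polarPoint a c s h) (polarPoint b c s h) = b - a := by
  refine dist_eq_of_cosh_dist_eq (by linarith) ?_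
  rw [cosh_dist_polarPoint, Real.cosh_sub]
  linear_combination (-Real.sinh a * Real.sinh b) * h

theorem three_halves_le_cosh_one : (3 : ℝ) / 2 ≤ Real.cosh 1 := by
  have h1 := Real.cosh_two_mul (1 / 2)
  have h2 := Real.cosh_sq (1 / 2)
  have h3 : (1 : ℝ) / 2 ≤ Real.sinh (1 / 2) := Real.self_le_sinh_iff.2 (by norm_num)
  rw [show (2 : ℝ) * (1 / 2) = 1 by norm_num] at h1
  nlinarith

theorem sinh_mul_sinh_sub_le {a α : ℝ} (ha : 0 ≤ a) :
    Real.sinh α * Real.sinh (a - α) ≤ Real.sinh a / 2 := by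
  have h1 : Real.cosh a = Real.cosh α * Real.cosh (a - α) + Real.sinh α * Real.sinh (a - α) := by
    rw [← Real.cosh_add]; ring_nf
  have h2 : Real.cosh (α - (a - α)) =
      Real.cosh α * Real.cosh (a - α) - Real.sinh α * Real.sinh (a - α) := Real.cosh_sub _ _
  have h3 := Real.one_le_cosh (α - (a - α))
  have h4 : Real.cosh a - Real.sinh a ≤ 1 := by
    rw [Real.cosh_sub_sinh]; exact Real.exp_le_one_iff.2 (by linarith)
  linarith

theorem IsGeodesicSpace.exists_dist_eq {X : Type*} [MetricSpace X] (hX : IsGeodesicSpace X)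
    (x y : X) {t : ℝ} (h0 : 0 ≤ t) (ht : t ≤ dist x y) :
    ∃ z, dist x z = t ∧ dist z y = dist x y - t := by
  obtain ⟨γ, h1, h2, h3⟩ := hX x y
  refine ⟨γ t, ?_, ?_⟩
  · have := h3 0 ⟨le_rfl, dist_nonneg⟩ t ⟨h0, ht⟩
    rw [h1] at this
    rw [this, zero_sub, abs_neg, abs_of_nonneg h0]
  · have := h3 t ⟨h0, ht⟩ (dist x y) ⟨dist_nonneg, le_rfl⟩
    rw [h2] at this
    rw [this, abs_sub_comm, abs_of_nonneg (by linarith)]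

/-- In a CAT(-1) space, two points on sides from `p` that are at the same distance `t ≤ (q|r)_p`
from `p` are at distance at most one. -/
theorem IsCATNegOne.dist_le_one {X : Type*} [MetricSpace X] (hX : IsCATNegOne X)
    {p q r x y : X} {t : ℝ} (ht : t ≤ gromovProd p q r)
    (hx : dist p x = t) (hx' : dist x q = dist p q - t)
    (hy : dist p y = t) (hy' : dist y r = dist p r - t) : dist x y ≤ 1 := by
  have ht0 : 0 ≤ t := hx ▸ dist_nonneg
  rcases ht0.eq_or_lt with rfl | htpos
  · rw [← dist_eq_zero.1 hx, ← dist_eq_zero.1 hy, dist_self]; exact zero_le_one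
  set a := dist p q with ha
  set b := dist p r with hb
  set c := dist q r with hc
  set α := (a + b - c) / 2 with hα
  have htα : t ≤ α := by
    rw [gromovProd, dist_comm q p, dist_comm r p] at ht; exact ht
  have hca : a ≤ b + c := by
    have := dist_triangle p r q; rw [dist_comm r q] at this; linarith
  have hcb : b ≤ a + c := by have := dist_triangle p q r; linarith
  have hcab : c ≤ a + b := by
    have := dist_triangle q p r; rw [dist_comm q p] at this; linarith
  have hapos : 0 < a := by linarith
  have hbpos : 0 < b := by linarith
  have hsa : 0 < Real.sinh a := Real.sinh_pos_iff.2 hapos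
  have hsb : 0 < Real.sinh b := Real.sinh_pos_iff.2 hbpos
  set k := (Real.cosh a * Real.cosh b - Real.cosh c) / (Real.sinh a * Real.sinh b) with hk
  have hk' : Real.sinh a * Real.sinh b * k = Real.cosh a * Real.cosh b - Real.cosh c := by
    rw [hk]; field_simp
  have h1k : 1 - k = 2 * Real.sinh (a - α) * Real.sinh (b - α) / (Real.sinh a * Real.sinh b) := by
    rw [eq_div_iff (by positivity)]
    have e1 : Real.cosh c = Real.cosh (a - α) * Real.cosh (b - α) +
        Real.sinh (a - α) * Real.sinh (b - α) := by
      rw [← Real.cosh_add]; congr 1; rw [hα]; ring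
    have e2 : Real.cosh (a - b) = Real.cosh (a - α) * Real.cosh (b - α) -
        Real.sinh (a - α) * Real.sinh (b - α) := by
      rw [← Real.cosh_sub]; congr 1; ring
    rw [Real.cosh_sub] at e2
    linear_combination e1 - e2 - hk'
  have hsaα : 0 ≤ Real.sinh (a - α) := Real.sinh_nonneg_iff.2 (by linarith)
  have hsbα : 0 ≤ Real.sinh (b - α) := Real.sinh_nonneg_iff.2 (by linarith)
  have hk1 : k ≤ 1 := by
    have : 0 ≤ 1 - k := by rw [h1k]; positivity
    linarith
  have hk2 : -1 ≤ k := by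
    rw [hk, le_div_iff₀ (by positivity)]
    have : Real.cosh c ≤ Real.cosh (a + b) := by
      rw [Real.cosh_le_cosh, abs_of_nonneg dist_nonneg, abs_of_nonneg (by linarith)]; exact hcab
    rw [Real.cosh_add] at this
    linarith
  have hks : k ^ 2 + Real.sqrt (1 - k ^ 2) ^ 2 = 1 := by
    rw [Real.sq_sqrt (by nlinarith)]; ring
  have h10 : (1 : ℝ) ^ 2 + 0 ^ 2 = 1 := by norm_num
  have hzero : polarPoint 0 1 0 h10 = polarPoint 0 k (Real.sqrt (1 - k ^ 2)) hks := by
    refine dist_eq_zero.1 (dist_eq_of_cosh_dist_eq le_rfl ?_)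
    rw [cosh_dist_polarPoint]; simp
  have hqr : dist (polarPoint a 1 0 h10) (polarPoint b k (Real.sqrt (1 - k ^ 2)) hks) = c := by
    refine dist_eq_of_cosh_dist_eq dist_nonneg ?_
    rw [cosh_dist_polarPoint]
    linear_combination -hk'
  have key := hX.2 p q r x y (polarPoint 0 1 0 h10) (polarPoint a 1 0 h10)
    (polarPoint b k (Real.sqrt (1 - k ^ 2)) hks) (polarPoint t 1 0 h10)
    (polarPoint t k (Real.sqrt (1 - k ^ 2)) hks)
    (by rw [hx, hx']; ring) (by rw [hy, hy']; ring)
    (by rw [dist_polarPoint_same hapos.le]; ring)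
    (by rw [hzero, dist_polarPoint_same hbpos.le]; ring)
    hqr
    (by rw [dist_polarPoint_same ht0, hx]; ring)
    (by rw [dist_polarPoint_same (by linarith), hx'])
    (by rw [hzero, dist_polarPoint_same ht0, hy]; ring)
    (by rw [dist_polarPoint_same (by linarith), hy'])
  refine key.trans ?_
  set d := dist (polarPoint t 1 0 h10) (polarPoint t k (Real.sqrt (1 - k ^ 2)) hks) with hd
  have hcd : Real.cosh d = 1 + Real.sinh t ^ 2 * (1 - k) := by
    rw [hd, cosh_dist_polarPoint, ← sq, Real.cosh_sq]; ring
  have hst : Real.sinh t ^ 2 ≤ Real.sinh α ^ 2 := by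
    have := Real.sinh_le_sinh.2 htα
    have := Real.sinh_nonneg_iff.2 ht0
    gcongr
  have hb1 : Real.sinh t ^ 2 * (1 - k) ≤ 1 / 2 := by
    calc Real.sinh t ^ 2 * (1 - k) ≤ Real.sinh α ^ 2 * (1 - k) := by
          gcongr
      _ = 2 * (Real.sinh α * Real.sinh (a - α)) * (Real.sinh α * Real.sinh (b - α)) /
            (Real.sinh a * Real.sinh b) := by rw [h1k]; ring
      _ ≤ 2 * (Real.sinh a / 2) * (Real.sinh b / 2) / (Real.sinh a * Real.sinh b) := by
          have := sinh_mul_sinh_sub_le (α := α) hapos.le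
          have := sinh_mul_sinh_sub_le (α := α) hbpos.le
          have : 0 ≤ Real.sinh α := Real.sinh_nonneg_iff.2 (by linarith)
          gcongr
      _ = 1 / 2 := by field_simp
  by_contra! hd1
  have : Real.cosh 1 < Real.cosh d := by
    rw [Real.cosh_lt_cosh, abs_of_pos one_pos, abs_of_pos (by linarith)]; exact hd1
  have h32 := three_halves_le_cosh_one
  linarith

theorem IsCATNegOne.isGromovHyperbolic {X : Type*} [MetricSpace X] (hX : IsCATNegOne X) :
    IsGromovHyperbolic X := by
  refine ⟨1, fun w x y z => ?_⟩
  set t := min (gromovProd w x y) (gromovProd w y z) with ht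
  have h1 : t ≤ gromovProd w x y := min_le_left _ _
  have h2 : t ≤ gromovProd w y z := min_le_right _ _
  have h0 : 0 ≤ t := by
    refine le_min ?_ ?_ <;> unfold gromovProd
    · have := dist_triangle_right x y w; linarith
    · have := dist_triangle_right y z w; linarith
  have hx : t ≤ dist w x := by
    unfold gromovProd at h1
    linarith [dist_triangle y x w, dist_comm x w, dist_comm x y]
  have hy : t ≤ dist w y := by
    unfold gromovProd at h1
    linarith [dist_triangle x y w, dist_comm y w]
  have hz : t ≤ dist w z := by
    unfold gromovProd at h2
    linarith [dist_triangle y z w, dist_comm z w]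
  obtain ⟨x', hx1, hx2⟩ := hX.1.exists_dist_eq w x h0 hx
  obtain ⟨y', hy1, hy2⟩ := hX.1.exists_dist_eq w y h0 hy
  obtain ⟨z', hz1, hz2⟩ := hX.1.exists_dist_eq w z h0 hz
  have a1 := hX.dist_le_one h1 hx1 hx2 hy1 hy2
  have a2 := hX.dist_le_one h2 hy1 hy2 hz1 hz2
  have a3 : dist x z ≤ dist x x' + dist x' y' + dist y' z' + dist z' z := by
    linarith [dist_triangle x x' z, dist_triangle x' y' z, dist_triangle y' z' z]
  rw [dist_comm x x'] at a3
  unfold gromovProd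
  rw [dist_comm x w, dist_comm z w]
  linarith

/-! ### The topology of the horofunction compactification -/

section HoroBord

variable {X : Type*} [MetricSpace X]

theorem HoroBord.continuous_apply (p q : X) : Continuous fun h : HoroBord X => h.1 p q :=
  (continuous_apply_apply p q).comp continuous_subtype_val

theorem HoroBord.denseRange_incl : DenseRange (HoroBord.incl (X := X)) := by
  intro h
  refine closure_subtype.2 ?_
  refine closure_mono ?_ h.2
  rintro _ ⟨z, rfl⟩
  exact ⟨HoroBord.incl z, ⟨z, rfl⟩, rfl⟩

/-- A closed property of points of `X` extends to the horofunction compactification. -/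
theorem HoroBord.induction_on {P : HoroBord X → Prop} (h : HoroBord X)
    (hP : IsClosed {h | P h}) (hX : ∀ z, P (HoroBord.incl z)) : P h :=
  HoroBord.denseRange_incl.induction_on h hP hX

theorem HoroBord.continuous_incl : Continuous (HoroBord.incl (X := X)) := by
  refine Continuous.subtype_mk ?_ _
  unfold distCocycle
  fun_prop

theorem HoroBord.abs_le (h : HoroBord X) (p q : X) : |h.1 p q| ≤ dist p q := by
  refine h.induction_on (isClosed_le (HoroBord.continuous_apply p q).abs continuous_const) ?_
  intro z
  exact abs_dist_sub_le p q z

theorem HoroBord.add (h : HoroBord X) (p q s : X) : h.1 p q + h.1 q s = h.1 p s := by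
  refine h.induction_on (isClosed_eq (f := fun h : HoroBord X => h.1 p q + h.1 q s)
    ((HoroBord.continuous_apply p q).add (HoroBord.continuous_apply q s))
    (HoroBord.continuous_apply p s)) ?_
  intro z
  simp only [HoroBord.incl, distCocycle]; ring

theorem HoroBord.self (h : HoroBord X) (p : X) : h.1 p p = 0 := by
  linarith [h.add p p p]

theorem HoroBord.neg (h : HoroBord X) (p q : X) : h.1 p q = - h.1 q p := by
  linarith [h.add p q p, h.self p]

instance : T2Space (HoroBord X) :=
  inferInstanceAs (T2Space {h : X → X → ℝ // h ∈ closure (range (distCocycle (X := X)))})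

instance : CompactSpace (HoroBord X) := by
  refine isCompact_iff_compactSpace.1 ?_
  have hK : IsCompact (univ.pi fun p : X => univ.pi fun q : X => Icc (-dist p q) (dist p q)) :=
    isCompact_univ_pi fun p => isCompact_univ_pi fun q => isCompact_Icc
  refine hK.of_isClosed_subset isClosed_closure (closure_minimal ?_ hK.isClosed)
  rintro _ ⟨z, rfl⟩ p - q -
  exact abs_le.1 (abs_dist_sub_le p q z)

instance [ProperSpace X] : TopologicalSpace.MetrizableSpace (HoroBord X) := by
  rcases isEmpty_or_nonempty X with hX | hX
  · have : Subsingleton (HoroBord X) := inferInstanceAs (Subsingleton {h : X → X → ℝ // _})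
    infer_instance
  let F : HoroBord X → ℕ → ℕ → ℝ := fun h i j =>
    h.1 (TopologicalSpace.denseSeq X i) (TopologicalSpace.denseSeq X j)
  have hF : Continuous F := continuous_pi fun i => continuous_pi fun j =>
    HoroBord.continuous_apply _ _
  have hd := TopologicalSpace.denseRange_denseSeq X
  have hinj : Function.Injective F := by
    intro a b hab
    have key : ∀ p q : X, a.1 p q = b.1 p q := by
      have hl : ∀ c : HoroBord X, Continuous fun x : X × X => c.1 x.1 x.2 := by
        intro c
        have : (fun x : X × X => c.1 x.1 x.2) = fun x => c.1 x.1 hX.some - c.1 x.2 hX.some := by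
          funext x; rw [← c.add x.1 hX.some x.2, c.neg hX.some]; ring
        have hc : Continuous fun x => c.1 x hX.some := by
          refine (LipschitzWith.of_dist_le_mul (K := 1) fun x y => ?_).continuous
          rw [Real.dist_eq, NNReal.coe_one, one_mul]
          have := c.abs_le x y
          rwa [show c.1 x hX.some - c.1 y hX.some = c.1 x y by linarith [c.add x y hX.some]]
        rw [this]
        exact (hc.comp continuous_fst).sub (hc.comp continuous_snd)
      have := (hd.prodMap hd).equalizer (hl a) (hl b) (by
        funext ij
        exact congrFun (congrFun hab ij.1) ij.2)
      exact fun p q => congrFun this (p, q)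
    exact Subtype.ext (funext fun p => funext fun q => key p q)
  exact (hF.isClosedEmbedding hinj).isEmbedding.metrizableSpace

/-- The points `x` at distance `t` from `o` on a geodesic from `o` to `h`: the sets of those `h`
for which there is one are closed. -/
theorem HoroBord.isClosed_setOf_exists [ProperSpace X] (o : X) (t : ℝ) :
    IsClosed {h : HoroBord X | ∃ x, dist o x = t ∧ h.1 x o = -t} := by
  rw [isClosed_iff_ultrafilter]
  intro h U hU hS
  have hS' : ∀ a : HoroBord X, ∃ x, a ∈ {h : HoroBord X | ∃ x, dist o x = t ∧ h.1 x o = -t} →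
      dist o x = t ∧ a.1 x o = -t := by
    intro a
    by_cases ha : a ∈ {h : HoroBord X | ∃ x, dist o x = t ∧ h.1 x o = -t}
    · obtain ⟨x, hx⟩ := ha; exact ⟨x, fun _ => hx⟩
    · exact ⟨o, fun h => absurd h ha⟩
  choose φ hφ using hS'
  have hc : IsCompact (Metric.sphere o t) := isCompact_sphere o t
  have hm : Metric.sphere o t ∈ U.map φ := by
    refine Ultrafilter.mem_map.2 ?_
    filter_upwards [hS] with a ha
    rw [mem_preimage, Metric.mem_sphere, dist_comm]; exact (hφ a ha).1
  obtain ⟨x, hx, hUx⟩ := hc.ultrafilter_le_nhds (U.map φ) (le_principal_iff.2 hm)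
  have hφx : Tendsto φ U (𝓝 x) := hUx
  refine ⟨x, by rw [dist_comm]; exact hx, ?_⟩
  have h1 : Tendsto (fun a : HoroBord X => a.1 x o) U (𝓝 (h.1 x o)) :=
    ((HoroBord.continuous_apply x o).tendsto h).mono_left hU
  have h2 : Tendsto (fun a : HoroBord X => a.1 x (φ a)) U (𝓝 0) := by
    refine squeeze_zero_norm (fun a => a.abs_le x (φ a)) ?_
    simpa using (tendsto_const_nhds (x := x)).dist hφx
  have h3 : Tendsto (fun a : HoroBord X => a.1 x o) U (𝓝 (0 + -t)) := by
    refine (h2.add_const (-t)).congr' ?_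
    filter_upwards [hS] with a ha
    rw [← (hφ a ha).2, a.add]
  simpa using tendsto_nhds_unique h1 h3

theorem HoroBord.exists_of_notMem_range [ProperSpace X] (hX : IsGeodesicSpace X) (o : X)
    {h : HoroBord X} (hh : h ∉ range (HoroBord.incl (X := X))) {t : ℝ} (ht : 0 ≤ t) :
    ∃ x, dist o x = t ∧ h.1 x o = -t := by
  have hcl : h ∈ closure (HoroBord.incl '' Metric.closedBall o t ∪
      HoroBord.incl '' (Metric.closedBall o t)ᶜ) := by
    rw [← image_union, union_compl_self, image_univ]
    exact HoroBord.denseRange_incl h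
  rw [closure_union] at hcl
  rcases hcl with h1 | h1
  · rw [((isCompact_closedBall o t).image HoroBord.continuous_incl).isClosed.closure_eq] at h1
    exact absurd (image_subset_range _ _ h1) hh
  · refine closure_minimal ?_ (HoroBord.isClosed_setOf_exists o t) h1
    rintro _ ⟨z, hz, rfl⟩
    rw [mem_compl_iff, Metric.mem_closedBall, not_le, dist_comm] at hz
    obtain ⟨x, hx1, hx2⟩ := hX.exists_dist_eq o z ht hz.le
    refine ⟨x, hx1, ?_⟩
    simp only [HoroBord.incl, distCocycle, hx2]; ring

theorem HoroBord.isClosed_compl_range_incl [ProperSpace X] (hX : IsGeodesicSpace X) :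
    IsClosed (range (HoroBord.incl (X := X)))ᶜ := by
  rcases isEmpty_or_nonempty X with he | ⟨⟨o⟩⟩
  · rw [range_eq_empty, compl_empty]; exact isClosed_univ
  have : (range (HoroBord.incl (X := X)))ᶜ =
      ⋂ n : ℕ, {h : HoroBord X | ∃ x, dist o x = n ∧ h.1 x o = -n} := by
    ext h
    rw [mem_iInter]
    refine ⟨fun hh n => HoroBord.exists_of_notMem_range hX o hh n.cast_nonneg, ?_⟩
    rintro hh ⟨z, rfl⟩
    obtain ⟨n, hn⟩ := exists_nat_gt (dist o z)
    obtain ⟨x, -, hx⟩ := hh n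
    simp only [HoroBord.incl, distCocycle] at hx
    linarith [dist_nonneg (x := x) (y := z)]
  rw [this]
  exact isClosed_iInter fun n => HoroBord.isClosed_setOf_exists o n

end HoroBord

/-! ### Hyperbolicity at infinity -/

section Hyperbolic

/-- The four point condition with constant `δ`. -/
def IsHyperbolicWith (X : Type*) [MetricSpace X] (δ : ℝ) : Prop :=
  ∀ w x y z : X, min (gromovProd w x y) (gromovProd w y z) - δ ≤ gromovProd w x z

variable {X : Type*} [MetricSpace X] {δ : ℝ}

theorem hyperbolicity_nonneg (hδ : IsHyperbolicWith X δ) (o : X) : 0 ≤ δ := by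
  have := hδ o o o o
  simp only [min_self] at this
  linarith

/-- The Gromov product of `p` and `h` is `(dist p o + h o p) / 2`. -/
theorem HoroBord.gromovProd_ge_left (hδ : IsHyperbolicWith X δ) (o p x : X) (h : HoroBord X) :
    min (gromovProd o x p) ((dist p o + h.1 o p) / 2) - δ ≤ (dist x o + h.1 o x) / 2 := by
  refine h.induction_on (P := fun h => min (gromovProd o x p) ((dist p o + h.1 o p) / 2) - δ ≤
    (dist x o + h.1 o x) / 2) (isClosed_le ?_ ?_) ?_
  · exact (continuous_const.min ((continuous_const.add
      (HoroBord.continuous_apply o p)).div_const 2)).sub continuous_const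
  · exact (continuous_const.add (HoroBord.continuous_apply o x)).div_const 2
  · intro z
    have := hδ o x p z
    simp only [HoroBord.incl, distCocycle]
    simp only [gromovProd] at this ⊢
    rw [dist_comm o z]
    convert this using 3 <;> ring

theorem HoroBord.gromovProd_ge_right (hδ : IsHyperbolicWith X δ) (o p x : X) (h : HoroBord X) :
    min ((dist x o + h.1 o x) / 2) ((dist p o + h.1 o p) / 2) - δ ≤ gromovProd o x p := by
  refine h.induction_on (P := fun h => min ((dist x o + h.1 o x) / 2)
    ((dist p o + h.1 o p) / 2) - δ ≤ gromovProd o x p) (isClosed_le ?_ ?_) ?_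
  · exact (((continuous_const.add (HoroBord.continuous_apply o x)).div_const 2).min
      ((continuous_const.add (HoroBord.continuous_apply o p)).div_const 2)).sub continuous_const
  · exact continuous_const
  · intro z
    have := hδ o x z p
    simp only [HoroBord.incl, distCocycle]
    simp only [gromovProd] at this ⊢
    rw [dist_comm o z]
    rw [dist_comm z p] at this
    convert this using 4 <;> ring

/-- If `x` is the point at distance `t` from `o` on a geodesic from `o` to `h`, then the horofunction
`h` at `p`, for `p` in the ball of radius `t` about `o`, is given by the distance to `x`. -/
theorem HoroBord.apply_le_of_dist_le (hδ : IsHyperbolicWith X δ) {o x p : X} {t : ℝ} {h : HoroBord X} (hx : dist o x = t)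
    (hhx : h.1 x o = -t) (hp : dist o p ≤ t) : h.1 o p - t ≤ -dist x p + 4 * δ := by
  have h1 := HoroBord.gromovProd_ge_right hδ o p x h
  have h2 := h.neg o x
  have h3 := le_of_abs_le (h.abs_le o p)
  have h4 := dist_comm x o
  have h5 := dist_comm p o
  have h6 := hyperbolicity_nonneg hδ o
  simp only [gromovProd] at h1
  rw [min_eq_right (by linarith)] at h1
  linarith

theorem HoroBord.le_apply {o x p : X} {t : ℝ} {h : HoroBord X}
    (hhx : h.1 x o = -t) : -dist x p ≤ h.1 o p - t := by
  have h1 := neg_le_of_abs_le (h.abs_le x p)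
  have h2 := h.neg o x
  have h3 := h.add x o p
  linarith

theorem HoroBord.apply_le_apply_add [ProperSpace X] (hδ : IsHyperbolicWith X δ)
    (hX : IsGeodesicSpace X) {a b : HoroBord X}
    (ha : a ∉ range (HoroBord.incl (X := X))) {C : ℝ} (hC : ∀ p q, |a.1 p q - b.1 p q| ≤ C)
    (o p : X) : b.1 p o ≤ a.1 p o + 8 * δ := by
  obtain ⟨x, hx, hax⟩ := HoroBord.exists_of_notMem_range hX o ha (dist_nonneg (x := o) (y := p))
  set s := dist o p with hs
  have hs0 : 0 ≤ s := dist_nonneg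
  have hC0 : 0 ≤ C := (abs_nonneg _).trans (hC o o)
  have hδ0 := hyperbolicity_nonneg hδ o
  obtain ⟨y, hy, hay⟩ := HoroBord.exists_of_notMem_range hX o ha (t := s + C) (by linarith)
  have h1 := HoroBord.gromovProd_ge_right hδ o y x a
  have h2 := HoroBord.gromovProd_ge_left hδ o y x b
  rw [dist_comm x o, dist_comm y o, a.neg o, a.neg o, hx, hy, hax, hay,
    min_eq_left (by linarith)] at h1
  rw [dist_comm x o, dist_comm y o, hx, hy] at h2
  have h3 := neg_le_of_abs_le (hC y o)
  have h4 := b.neg o y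
  have h5 : s - δ ≤ min (gromovProd o x y) ((s + C + b.1 o y) / 2) :=
    le_min (by linarith) (by linarith)
  have h6 := HoroBord.apply_le_of_dist_le hδ hx hax hs.ge
  have h7 := b.add p x o
  have h8 := le_of_abs_le (b.abs_le p x)
  have h9 := b.neg o x
  have h10 := a.neg o p
  rw [dist_comm p x] at h8
  linarith

/-- Horofunctions at bounded distance are at uniformly bounded distance. -/
theorem HoroBord.abs_sub_le_of_bounded [ProperSpace X] (hδ : IsHyperbolicWith X δ)
    (hX : IsGeodesicSpace X)
    {a b : HoroBord X} (ha : a ∉ range (HoroBord.incl (X := X)))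
    (hb : b ∉ range (HoroBord.incl (X := X))) {C : ℝ} (hC : ∀ p q, |a.1 p q - b.1 p q| ≤ C)
    (p q : X) : |a.1 p q - b.1 p q| ≤ 8 * δ := by
  have hC' : ∀ p q, |b.1 p q - a.1 p q| ≤ C := fun p q => by rw [abs_sub_comm]; exact hC p q
  have h1 := HoroBord.apply_le_apply_add hδ hX ha hC q p
  have h2 := HoroBord.apply_le_apply_add hδ hX hb hC' q p
  exact _root_.abs_le.2 ⟨by linarith, by linarith⟩

theorem gromovSetoid_rel_iff [ProperSpace X] (hδ : IsHyperbolicWith X δ)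
    (hX : IsGeodesicSpace X) (a b : HoroBord X) :
    gromovSetoid X a b ↔ a = b ∨ (a ∈ (range (HoroBord.incl (X := X)))ᶜ ∧
      b ∈ (range (HoroBord.incl (X := X)))ᶜ ∧ ∀ p q : X, |a.1 p q - b.1 p q| ≤ 8 * δ) := by
  constructor
  · rintro (h | ⟨ha, hb, C, hC⟩)
    · exact Or.inl h
    · exact Or.inr ⟨ha, hb, HoroBord.abs_sub_le_of_bounded hδ hX ha hb hC⟩
  · rintro (h | ⟨ha, hb, hC⟩)
    · exact Or.inl h
    · exact Or.inr ⟨ha, hb, _, hC⟩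

theorem isClosed_setOf_gromovSetoid [ProperSpace X] (hδ : IsHyperbolicWith X δ)
    (hX : IsGeodesicSpace X) :
    IsClosed {x : HoroBord X × HoroBord X | gromovSetoid X x.1 x.2} := by
  simp only [gromovSetoid_rel_iff hδ hX, ofPred_or, ofPred_and, ofPred_forall]
  have hc := HoroBord.isClosed_compl_range_incl hX
  refine (isClosed_eq continuous_fst continuous_snd).union
    ((hc.preimage continuous_fst).inter ((hc.preimage continuous_snd).inter
      (isClosed_iInter fun p => isClosed_iInter fun q => isClosed_le ?_ continuous_const)))
  exact (((HoroBord.continuous_apply p q).comp continuous_fst).sub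
    ((HoroBord.continuous_apply p q).comp continuous_snd)).abs

/-- A quotient of a compact Hausdorff space by a closed equivalence relation is Hausdorff. -/
theorem t2Space_quotient_of_isClosed {Y : Type*} [TopologicalSpace Y] [CompactSpace Y] [T2Space Y]
    (s : Setoid Y) (hs : IsClosed {x : Y × Y | s x.1 x.2}) : T2Space (Quotient s) := by
  have hclosed : IsClosedMap (Quotient.mk s) := by
    intro A hA
    refine (isQuotientMap_quotient_mk' (s := s)).isClosed_preimage.1 ?_
    have : Quotient.mk s ⁻¹' (Quotient.mk s '' A) =
        Prod.snd '' ({x : Y × Y | s x.1 x.2} ∩ Prod.fst ⁻¹' A) := by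
      ext y
      constructor
      · rintro ⟨a, ha, hay⟩
        exact ⟨(a, y), ⟨Quotient.exact hay, ha⟩, rfl⟩
      · rintro ⟨⟨a, y'⟩, ⟨h1, h2⟩, rfl⟩
        exact ⟨a, h2, Quotient.sound h1⟩
    change IsClosed (Quotient.mk s ⁻¹' (Quotient.mk s '' A))
    rw [this]
    exact isClosedMap_snd_of_compactSpace _ (hs.inter (hA.preimage continuous_fst))
  have hcont : Continuous (Quotient.mk s) := continuous_quotient_mk'
  have hsing : ∀ y : Quotient s, IsClosed ({y} : Set (Quotient s)) := by
    intro y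
    obtain ⟨a, rfl⟩ := Quotient.exists_rep y
    simpa using hclosed {a} isClosed_singleton
  refine ⟨fun y z hyz => ?_⟩
  obtain ⟨U, V, hU, hV, hyU, hzV, hUV⟩ := normal_separation ((hsing y).preimage hcont)
    ((hsing z).preimage hcont) (disjoint_singleton.2 hyz |>.preimage _)
  refine ⟨(Quotient.mk s '' Uᶜ)ᶜ, (Quotient.mk s '' Vᶜ)ᶜ,
    (hclosed _ hU.isClosed_compl).isOpen_compl, (hclosed _ hV.isClosed_compl).isOpen_compl,
    ?_, ?_, ?_⟩
  · rintro ⟨a, ha, hay⟩; exact ha (hyU hay)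
  · rintro ⟨a, ha, hay⟩; exact ha (hzV hay)
  · rw [disjoint_left]
    intro w hw1 hw2
    obtain ⟨a, rfl⟩ := Quotient.exists_rep w
    have haU : a ∈ U := by by_contra h; exact hw1 ⟨a, h, rfl⟩
    have haV : a ∈ V := by by_contra h; exact hw2 ⟨a, h, rfl⟩
    exact disjoint_left.1 hUV haU haV

theorem GromovBord.t2Space [ProperSpace X] (hδ : IsHyperbolicWith X δ)
    (hX : IsGeodesicSpace X) : T2Space (GromovBord X) :=
  t2Space_quotient_of_isClosed _ (isClosed_setOf_gromovSetoid hδ hX)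

/-- The projection of the horofunction compactification to the Gromov compactification. -/
def HoroBord.toGromovBord (h : HoroBord X) : GromovBord X := Quotient.mk (gromovSetoid X) h

theorem HoroBord.continuous_toGromovBord :
    Continuous (HoroBord.toGromovBord (X := X)) :=
  continuous_quotient_mk'

theorem HoroBord.abs_sub_le_of_toGromovBord_eq [ProperSpace X] (hδ : IsHyperbolicWith X δ)
    (hX : IsGeodesicSpace X) {a b : HoroBord X} (h : a.toGromovBord = b.toGromovBord) (p q : X) :
    |a.1 p q - b.1 p q| ≤ 8 * δ := by
  rcases (gromovSetoid_rel_iff hδ hX a b).1 (Quotient.exact h) with rfl | ⟨-, -, h⟩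
  · simpa using hyperbolicity_nonneg hδ p
  · exact h p q

end Hyperbolic

/-! ### Comparability up to multiplicative constants -/

theorem Comparable.symm {K : ℝ≥0} {a b : ℝ≥0∞} (h : Comparable K a b) : Comparable K b a :=
  ⟨h.2, h.1⟩

theorem Comparable.trans {K K' : ℝ≥0} {a b c : ℝ≥0∞} (h : Comparable K a b)
    (h' : Comparable K' b c) : Comparable (K * K') a c := by
  constructor
  · calc a ≤ K * (K' * c) := h.1.trans (by gcongr; exact h'.1)
      _ = _ := by push_cast; ring
  · calc c ≤ K' * (K * a) := h'.2.trans (by gcongr; exact h.2)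
      _ = _ := by push_cast; ring

theorem Comparable.mono {K K' : ℝ≥0} {a b : ℝ≥0∞} (h : Comparable K a b) (hK : K ≤ K') :
    Comparable K' a b :=
  ⟨h.1.trans (by gcongr), h.2.trans (by gcongr)⟩

theorem Comparable.lintegral {S : Type*} [MeasurableSpace S] {μ : Measure S} {K : ℝ≥0}
    {f g : S → ℝ≥0∞} (h : ∀ᵐ x ∂μ, Comparable K (f x) (g x)) :
    Comparable K (∫⁻ x, f x ∂μ) (∫⁻ x, g x ∂μ) := by
  constructor
  · rw [← lintegral_const_mul' _ _ ENNReal.coe_ne_top]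
    exact lintegral_mono_ae (h.mono fun x hx => hx.1)
  · rw [← lintegral_const_mul' _ _ ENNReal.coe_ne_top]
    exact lintegral_mono_ae (h.mono fun x hx => hx.2)

theorem Comparable.div {K : ℝ≥0} {a b : ℝ≥0∞} (h : Comparable K a b) (E : ℝ≥0∞) :
    Comparable K (a / E) (b / E) := by
  simp only [Comparable, div_eq_mul_inv, ← mul_assoc]
  exact ⟨by gcongr; exact h.1, by gcongr; exact h.2⟩

theorem Comparable.of_tendsto {K : ℝ≥0} {a b : ℝ≥0∞} {u : ℕ → ℝ≥0∞}
    (hu : Tendsto u atTop (𝓝 b)) (h : ∀ᶠ n in atTop, Comparable K a (u n)) :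
    Comparable K a b :=
  ⟨ge_of_tendsto (ENNReal.Tendsto.const_mul hu (Or.inr ENNReal.coe_ne_top))
    (h.mono fun _ hn => hn.1), le_of_tendsto hu (h.mono fun _ hn => hn.2)⟩

theorem DensityBounds.measure_le {S : Type*} [MeasurableSpace S] {ν μ : Measure S}
    [IsProbabilityMeasure μ] {D : ℝ} (hD : 1 ≤ D) (h : DensityBounds ν μ D fun _ => 1) :
    ν ≤ ENNReal.ofReal D • μ ∧ μ ≤ ENNReal.ofReal D • ν := by
  have hD0 : 0 < D := by linarith
  obtain ⟨hac, hb⟩ := h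
  simp only [mul_one] at hb
  by_cases hL : ν.HaveLebesgueDecomposition μ
  · have hν := Measure.withDensity_rnDeriv_eq ν μ hac
    constructor
    · rw [← hν, ← withDensity_const]
      exact withDensity_mono (hb.mono fun x hx => hx.2)
    · have h1 : ENNReal.ofReal D⁻¹ • μ ≤ ν := by
        conv_rhs => rw [← hν]
        rw [← withDensity_const]
        exact withDensity_mono (hb.mono fun x hx => hx.1)
      calc μ = ENNReal.ofReal D • ENNReal.ofReal D⁻¹ • μ := by
            rw [smul_smul, ← ENNReal.ofReal_mul hD0.le, mul_inv_cancel₀ hD0.ne',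
              ENNReal.ofReal_one, one_smul]
        _ ≤ ENNReal.ofReal D • ν := by gcongr
  · exfalso
    rw [Measure.rnDeriv_of_not_haveLebesgueDecomposition hL] at hb
    obtain ⟨x, hx⟩ := hb.exists
    have := hx.1
    simp only [Pi.zero_apply, nonpos_iff_eq_zero, ENNReal.ofReal_eq_zero, inv_nonpos] at this
    linarith

theorem DensityBounds.comparable_lintegral {S : Type*} [MeasurableSpace S] {ν μ : Measure S}
    [IsProbabilityMeasure μ] {D : ℝ} (hD : 1 ≤ D) (h : DensityBounds ν μ D fun _ => 1)
    (f : S → ℝ≥0∞) : Comparable D.toNNReal (∫⁻ x, f x ∂ν) (∫⁻ x, f x ∂μ) := by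
  obtain ⟨h1, h2⟩ := h.measure_le hD
  constructor
  · exact (lintegral_mono' h1 le_rfl).trans_eq (lintegral_smul_measure _ _)
  · exact (lintegral_mono' h2 le_rfl).trans_eq (lintegral_smul_measure _ _)

/-! ### The maximal horofunction over an orbit ball -/

/-- The maximum over `g ∈ B_t` of `exp (v (h(o, g • o) - t))`. -/
def horoMax (G : Type*) {X : Type*} [MetricSpace X] [Group G] [MulAction G X] (v : ℝ) (o : X)
    (t : ℝ) (h : HoroBord X) : ℝ≥0∞ :=
  ⨆ g ∈ orbitBall G o t, ENNReal.ofReal (Real.exp (v * (h.1 o (g • o) - t)))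

theorem horoMax_le_one (G : Type*) {X : Type*} [MetricSpace X] [Group G] [MulAction G X]
    {v t : ℝ} (o : X) (hv : 0 ≤ v) (h : HoroBord X) : horoMax G v o t h ≤ 1 := by
  refine iSup₂_le fun g hg => ENNReal.ofReal_le_one.2 (Real.exp_le_one_iff.2 ?_)
  have h1 := le_of_abs_le (h.abs_le o (g • o))
  have h2 : dist o (g • o) ≤ t := hg
  exact mul_nonpos_of_nonneg_of_nonpos hv (by linarith)

theorem continuous_expDist (G : Type*) {X : Type*} [MetricSpace X] [Group G] [MulAction G X]
    (v : ℝ) (o : X) (t : ℝ) : Continuous (expDist G v o t) :=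
  ENNReal.continuous_ofReal.comp (Real.continuous_exp.comp
    (continuous_const.mul (Metric.continuous_infDist_pt _)))

section Orbit

variable (G : Type*) {X : Type*} [MetricSpace X] [ProperSpace X] [Group G] [MulAction G X]
  [ProperlyDiscontinuousSMul G X] (v : ℝ) (o : X) (t : ℝ)

theorem finite_orbitBall : (orbitBall G o t).Finite := by
  refine (finite_disjoint_inter_image (Γ := G) (isCompact_singleton (x := o))
    (isCompact_closedBall o t)).subset ?_
  intro g hg
  have hmem : g • o ∈ (fun x => g • x) '' {o} ∩ Metric.closedBall o t :=
    ⟨⟨o, rfl, rfl⟩, by rw [Metric.mem_closedBall, dist_comm]; exact hg⟩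
  exact ⟨_, hmem⟩

theorem continuous_horoMax : Continuous (horoMax G v o t) := by
  have : horoMax G v o t = fun h => (finite_orbitBall G o t).toFinset.sup fun g =>
      ENNReal.ofReal (Real.exp (v * (h.1 o (g • o) - t))) := by
    funext h
    simp [horoMax, Finset.sup_eq_iSup]
  rw [this]
  exact Continuous.finset_sup_apply fun g _ => ENNReal.continuous_ofReal.comp
    (Real.continuous_exp.comp (continuous_const.mul
      ((HoroBord.continuous_apply o (g • o)).sub continuous_const)))

variable {v o t}

theorem expDist_le_horoMax_and_le {δ : ℝ} (hδ : IsHyperbolicWith X δ) (hv : 0 ≤ v) {x : X}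
    {h : HoroBord X} (hx : dist o x = t) (hhx : h.1 x o = -t) :
    expDist G v o t x ≤ horoMax G v o t h ∧
      horoMax G v o t h ≤ ENNReal.ofReal (Real.exp (v * (4 * δ))) * expDist G v o t x := by
  constructor
  · have hne : ((fun g : G => g • o) '' orbitBall G o t).Nonempty := by
      refine ⟨_, mem_image_of_mem _ (show (1 : G) ∈ _ from ?_)⟩
      change dist o ((1 : G) • o) ≤ t
      rw [one_smul, dist_self, ← hx]; exact dist_nonneg
    obtain ⟨_, ⟨g, hg, rfl⟩, hd⟩ :=
      ((finite_orbitBall G o t).image _).isCompact.exists_infDist_eq_dist hne x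
    refine le_iSup₂_of_le g hg (ENNReal.ofReal_le_ofReal (Real.exp_le_exp.2 ?_))
    rw [hd, neg_mul, ← mul_neg]
    exact mul_le_mul_of_nonneg_left (HoroBord.le_apply hhx) hv
  · refine iSup₂_le fun g hg => ?_
    rw [expDist, ← ENNReal.ofReal_mul (Real.exp_pos _).le, ← Real.exp_add]
    refine ENNReal.ofReal_le_ofReal (Real.exp_le_exp.2 ?_)
    have h1 := HoroBord.apply_le_of_dist_le hδ hx hhx hg
    have h2 := Metric.infDist_le_dist_of_mem (x := x)
      (mem_image_of_mem (fun g : G => g • o) hg)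
    calc v * (h.1 o (g • o) - t) ≤
        v * (4 * δ - Metric.infDist x ((fun g : G => g • o) '' orbitBall G o t)) :=
          mul_le_mul_of_nonneg_left (by linarith) hv
      _ = _ := by ring

theorem comparable_expDist_horoMax {δ : ℝ} (hδ : IsHyperbolicWith X δ) (hv : 0 ≤ v) {x : X}
    {h : HoroBord X} (hx : dist o x = t) (hhx : h.1 x o = -t) :
    Comparable (Real.exp (v * (4 * δ))).toNNReal (expDist G v o t x) (horoMax G v o t h) := by
  obtain ⟨h1, h2⟩ := expDist_le_horoMax_and_le G hδ hv hx hhx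
  refine ⟨h1.trans (le_mul_of_one_le_left' ?_), h2⟩
  have := hyperbolicity_nonneg hδ o
  exact ENNReal.one_le_ofReal.2 (Real.one_le_exp (by positivity))

end Orbit

/-! ### Compactifications dominated by the horofunction compactification -/

section Compactification

variable {X B : Type*} [MetricSpace X] [TopologicalSpace B] [T2Space B] {c : ℝ}
  {κ : HoroBord X → B}

theorem abs_busemann_sub_le (hκ : Continuous κ)
    (hfib : ∀ a b, κ a = κ b → ∀ p q, |a.1 p q - b.1 p q| ≤ c) (h : HoroBord X) (p q : X) :
    |busemann (fun z => κ (HoroBord.incl z)) (κ h) p q - h.1 p q| ≤ c := by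
  have hne : (comap (fun z => κ (HoroBord.incl z)) (𝓝 (κ h))).NeBot := by
    refine comap_neBot_iff.2 fun s hs => ?_
    obtain ⟨_, ha, ⟨z, rfl⟩⟩ := mem_closure_iff_nhds.1 (HoroBord.denseRange_incl h) _
      (hκ.continuousAt.preimage_mem_nhds hs)
    exact ⟨z, ha⟩
  have hev : ∀ ε > 0, ∀ᶠ z in comap (fun z => κ (HoroBord.incl z)) (𝓝 (κ h)),
      |dist p z - dist q z - h.1 p q| < c + ε := by
    intro ε hε
    refine mem_iff_ultrafilter.2 fun U hU => ?_
    obtain ⟨a, -, ha⟩ := isCompact_univ.ultrafilter_le_nhds (U.map HoroBord.incl) (by simp)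
    have ha' : Tendsto HoroBord.incl U (𝓝 a) := ha
    have e : κ a = κ h := tendsto_nhds_unique ((hκ.tendsto a).comp ha') (tendsto_iff_comap.2 hU)
    have h1 : Tendsto (fun z => |dist p z - dist q z - h.1 p q|) U (𝓝 |a.1 p q - h.1 p q|) :=
      ((((HoroBord.continuous_apply p q).tendsto a).comp ha').sub_const _).abs
    exact h1.eventually (gt_mem_nhds (by linarith [hfib a h e p q]))
  have hb1 : ∀ z, dist p z - dist q z ≤ dist p q := fun z => le_of_abs_le (abs_dist_sub_le p q z)
  have hb2 : ∀ z, -dist p q ≤ dist p z - dist q z :=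
    fun z => neg_le_of_abs_le (abs_dist_sub_le p q z)
  have hB : IsBoundedUnder (· ≤ ·) (comap (fun z => κ (HoroBord.incl z)) (𝓝 (κ h)))
    (fun z : X => dist p z - dist q z) := isBoundedUnder_of ⟨_, hb1⟩
  have hB' : IsBoundedUnder (· ≥ ·) (comap (fun z => κ (HoroBord.incl z)) (𝓝 (κ h)))
    (fun z : X => dist p z - dist q z) := isBoundedUnder_of ⟨_, hb2⟩
  refine le_of_forall_pos_le_add fun ε hε => ?_
  rw [abs_le, busemann]
  constructor
  · have : h.1 p q - (c + ε) ≤ limsup (fun z : X => dist p z - dist q z)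
        (comap (fun z => κ (HoroBord.incl z)) (𝓝 (κ h))) :=
      le_limsup_of_frequently_le
        ((hev ε hε).mono fun z hz => by linarith [(abs_lt.1 hz).1]).frequently hB
    linarith
  · have : limsup (fun z : X => dist p z - dist q z)
        (comap (fun z => κ (HoroBord.incl z)) (𝓝 (κ h))) ≤ h.1 p q + (c + ε) :=
      limsup_le_of_le hB'.isCoboundedUnder_le
        ((hev ε hε).mono fun z hz => by linarith [(abs_lt.1 hz).2])
    linarith

/-- A geodesic ray that converges to `ξ` determines a horofunction over `ξ`. -/
theorem IsGeodesicRay.exists_horofunction (hκ : Continuous κ) {o : X} {γ : ℝ → X}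
    (hγ : IsGeodesicRay o γ) {ξ : B}
    (hξ : Tendsto (fun t => κ (HoroBord.incl (γ t))) atTop (𝓝 ξ)) :
    ∃ h, κ h = ξ ∧ ∀ t, 0 ≤ t → h.1 (γ t) o = -t := by
  set U := Ultrafilter.of (atTop : Filter ℝ)
  have hU : (U : Filter ℝ) ≤ atTop := Ultrafilter.of_le _
  obtain ⟨a, -, ha⟩ := isCompact_univ.ultrafilter_le_nhds
    (U.map fun t => HoroBord.incl (γ t)) (by simp)
  have ha' : Tendsto (fun t => HoroBord.incl (γ t)) U (𝓝 a) := ha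
  refine ⟨a, tendsto_nhds_unique ((hκ.tendsto a).comp ha') (hξ.mono_left hU), fun t ht => ?_⟩
  refine tendsto_nhds_unique (((HoroBord.continuous_apply (γ t) o).tendsto a).comp ha') ?_
  refine tendsto_const_nhds.congr' (EventuallyEq.filter_mono ?_ hU)
  filter_upwards [eventually_ge_atTop t] with T hT
  have h1 := hγ.2 t T ht (ht.trans hT)
  have h2 := hγ.2 0 T le_rfl (ht.trans hT)
  rw [hγ.1] at h2
  simp only [Function.comp, HoroBord.incl, distCocycle]
  rw [h1, h2, abs_of_nonpos (by linarith), abs_of_nonpos (by linarith)]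
  ring

end Compactification

/-! ### The extremal cocycle -/

theorem ae_mem_of_measure_compl {S : Type*} [MeasurableSpace S] {μ : Measure S} {s : Set S}
    (h : μ sᶜ = 0) : ∀ᵐ x ∂μ, x ∈ s :=
  (measure_eq_zero_iff_ae_notMem.1 h).mono fun _ hx => not_not.1 hx

theorem restrict_eq_self_of_measure_compl {S : Type*} [MeasurableSpace S] {μ : Measure S}
    {s : Set S} (h : μ sᶜ = 0) : μ.restrict s = μ :=
  Measure.restrict_eq_self_of_ae_mem (ae_mem_of_measure_compl h)

theorem IsWeakLimit.map {X B : Type*} [MetricSpace X] [MeasurableSpace X] [TopologicalSpace B]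
    [MeasurableSpace B] [BorelSpace B] {κ : HoroBord X → B} {I : Set ℝ} {m : ℝ → Measure X}
    (hκ : Continuous κ) {ν : Measure (HoroBord X)}
    (h : IsWeakLimit HoroBord.incl I m ν) :
    IsWeakLimit (fun z => κ (HoroBord.incl z)) I m (ν.map κ) := by
  obtain ⟨r, hrI, hr, hf⟩ := h
  refine ⟨r, hrI, hr, fun f => ?_⟩
  rw [integral_map hκ.measurable.aemeasurable f.continuous.aestronglyMeasurable]
  exact hf (f.compContinuous ⟨κ, hκ⟩)

section Cocycle

variable {G X B : Type*} [MetricSpace X] [ProperSpace X] [Group G] [MulAction G X]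
  [ProperlyDiscontinuousSMul G X] [MeasurableSpace B]
  {κ : HoroBord X → B} {act : G → B → B} {Λ : Set B} {μ : X → Measure B} {v C c t : ℝ} {o : X}

theorem measurable_maxDeriv : Measurable (maxDeriv G μ o t) :=
  Measurable.biSup _ (finite_orbitBall G o t).countable fun _ _ => Measure.measurable_rnDeriv _ _

variable [TopologicalSpace B]

theorem comparable_maxDeriv_horoMax [T2Space B] (hκ : Continuous κ)
    (hfib : ∀ a b, κ a = κ b → ∀ p q, |a.1 p q - b.1 p q| ≤ c) (hv : 0 ≤ v) (hC : 1 ≤ C)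
    (hμ : IsQuasiconformalDensity (fun z => κ (HoroBord.incl z)) act Λ v C μ) :
    ∀ᵐ ξ ∂(μ o), ∀ h, κ h = ξ → Comparable (C * Real.exp (v * c)).toNNReal
      (maxDeriv G μ o t ξ / ENNReal.ofReal (Real.exp (v * t))) (horoMax G v o t h) := by
  have hall : ∀ᵐ ξ ∂(μ o), ∀ g ∈ orbitBall G o t,
      ENNReal.ofReal (C⁻¹ * Real.exp (v * busemann (fun z => κ (HoroBord.incl z)) ξ o (g • o))) ≤
        (μ (g • o)).rnDeriv (μ o) ξ ∧ (μ (g • o)).rnDeriv (μ o) ξ ≤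
      ENNReal.ofReal (C * Real.exp (v * busemann (fun z => κ (HoroBord.incl z)) ξ o (g • o))) :=
    (ae_ball_iff (finite_orbitBall G o t).countable).2 fun g _ => (hμ.density (g • o) o).2
  filter_upwards [hall] with ξ hξ h hh
  subst hh
  have hE : ENNReal.ofReal (Real.exp (v * t)) ≠ 0 := by
    simpa using Real.exp_pos _
  have hC0 : 0 < C := by linarith
  have hbus := fun g : G => abs_le.1 (abs_busemann_sub_le hκ hfib h o (g • o))
  constructor
  · rw [ENNReal.div_le_iff hE ENNReal.ofReal_ne_top]
    refine iSup₂_le fun g hg => (hξ g hg).2.trans ?_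
    refine le_trans ?_ (mul_le_mul_left (mul_le_mul_right (le_iSup₂ g hg) _) _)
    change _ ≤ ENNReal.ofReal _ * _ * _
    rw [← ENNReal.ofReal_mul (by positivity), ← ENNReal.ofReal_mul (by positivity)]
    refine ENNReal.ofReal_le_ofReal ?_
    rw [mul_assoc, mul_assoc, ← Real.exp_add, ← Real.exp_add]
    refine mul_le_mul_of_nonneg_left (Real.exp_le_exp.2 ?_) hC0.le
    rw [← mul_add, ← mul_add]
    exact mul_le_mul_of_nonneg_left (by linarith [(hbus g).2]) hv
  · refine iSup₂_le fun g hg => ?_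
    rw [← mul_div_assoc, ENNReal.le_div_iff_mul_le (Or.inl hE) (Or.inl ENNReal.ofReal_ne_top)]
    have h1 : (μ (g • o)).rnDeriv (μ o) (κ h) ≤ maxDeriv G μ o t (κ h) :=
      le_iSup₂ (f := fun g (_ : g ∈ orbitBall G o t) => (μ (g • o)).rnDeriv (μ o) (κ h)) g hg
    refine le_trans ?_ (mul_le_mul_right ((hξ g hg).1.trans h1) _)
    change _ ≤ ENNReal.ofReal _ * _
    rw [← ENNReal.ofReal_mul (by positivity), ← ENNReal.ofReal_mul (by positivity)]
    refine ENNReal.ofReal_le_ofReal ?_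
    rw [← Real.exp_add, show ∀ a b : ℝ, C * a * (C⁻¹ * b) = a * b by intros; field_simp,
      ← Real.exp_add, ← mul_add, ← mul_add]
    exact Real.exp_le_exp.2 (mul_le_mul_of_nonneg_left (by linarith [(hbus g).1]) hv)

theorem comparable_extremalCocycle [T2Space B] (hκ : Continuous κ)
    (hfib : ∀ a b, κ a = κ b → ∀ p q, |a.1 p q - b.1 p q| ≤ c) (hv : 0 ≤ v) (hC : 1 ≤ C)
    (hμ : IsQuasiconformalDensity (fun z => κ (HoroBord.incl z)) act Λ v C μ)
    {δ : ℝ} (hδ : IsHyperbolicWith X δ) (ht : 0 ≤ t) {π : B → X}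
    (hπ : IsBoundaryProj (fun z => κ (HoroBord.incl z)) Λ o t π) :
    Comparable ((C * Real.exp (v * c)).toNNReal * (Real.exp (v * (4 * δ))).toNNReal)
      (extremalCocycle G Λ v μ o t) (∫⁻ ξ in Λ, expDist G v o t (π ξ) ∂(μ o)) := by
  rw [extremalCocycle, restrict_eq_self_of_measure_compl (hμ.carried o), div_eq_mul_inv,
    ← lintegral_mul_const _ measurable_maxDeriv]
  refine Comparable.lintegral ?_
  filter_upwards [ae_mem_of_measure_compl (hμ.carried o),
    comparable_maxDeriv_horoMax (t := t) (o := o) hκ hfib hv hC hμ] with ξ hξ hc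
  obtain ⟨γ, hγ, hlim, hπξ⟩ := hπ ξ hξ
  obtain ⟨h, rfl, hh⟩ := hγ.exists_horofunction hκ hlim
  rw [hπξ]
  have hd : dist o (γ t) = t := by
    have := hγ.2 0 t le_rfl ht
    rwa [hγ.1, zero_sub, abs_neg, abs_of_nonneg ht] at this
  exact (hc h rfl).trans (comparable_expDist_horoMax G hδ hv hd (hh t ht)).symm

/-! ### Weak limits of sphere measures -/

theorem exists_weak_limit [MeasurableSpace X] [BorelSpace X] {I : Set ℝ} (hI : ¬ BddAbove I)
    {m : ℝ → Measure X} (hm : AreSphereMeasures o I m) :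
    ∃ (ν : Measure (HoroBord X)) (r : ℕ → ℝ), IsProbabilityMeasure ν ∧ (∀ n, r n ∈ I) ∧
      Tendsto r atTop atTop ∧ ∀ f : HoroBord X →ᵇ ℝ,
        Tendsto (fun n => ∫ x, f (HoroBord.incl x) ∂(m (r n))) atTop (𝓝 (∫ h, f h ∂ν)) := by
  have hex : ∀ n : ℕ, ∃ s ∈ I, (n : ℝ) < s := fun n => by
    by_contra! h
    exact hI ⟨n, fun s hs => h s hs⟩
  choose s hsI hs using hex
  have hmeas : Measurable (HoroBord.incl (X := X)) := HoroBord.continuous_incl.measurable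
  have hprob : ∀ n, IsProbabilityMeasure ((m (s n)).map HoroBord.incl) := fun n =>
    have := (hm (s n) (hsI n)).1
    Measure.isProbabilityMeasure_map hmeas.aemeasurable
  obtain ⟨ν, φ, hφ, hlim⟩ := CompactSpace.tendsto_subseq
    (X := ProbabilityMeasure (HoroBord X)) (fun n => ⟨_, hprob n⟩)
  refine ⟨ν, s ∘ φ, inferInstance, fun n => hsI _, ?_, fun f => ?_⟩
  · exact (tendsto_atTop_mono (fun n => (hs n).le) tendsto_natCast_atTop_atTop).comp
      hφ.tendsto_atTop
  · refine ((ProbabilityMeasure.tendsto_iff_forall_integral_tendsto.1 hlim) f).congr fun n => ?_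
    exact integral_map hmeas.aemeasurable f.continuous.aestronglyMeasurable

theorem lintegral_horoMax_eq {S : Type*} [MeasurableSpace S] (ν : Measure S)
    [IsProbabilityMeasure ν] (hv : 0 ≤ v) {φ : S → HoroBord X} (hφ : Measurable φ) :
    ∫⁻ x, horoMax G v o t (φ x) ∂ν =
      ENNReal.ofReal (∫ x, (horoMax G v o t (φ x)).toReal ∂ν) := by
  have hfin : ∀ h, horoMax G v o t h ≠ ∞ := fun h =>
    ((horoMax_le_one G o hv h).trans_lt ENNReal.one_lt_top).ne
  have hmeas : Measurable fun x => horoMax G v o t (φ x) :=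
    (continuous_horoMax G v o t).measurable.comp hφ
  rw [integral_toReal hmeas.aemeasurable
    (ae_of_all _ fun x => (hfin _).lt_top), ENNReal.ofReal_toReal]
  refine ((lintegral_mono fun x => horoMax_le_one G o hv (φ x)).trans_lt ?_).ne
  simp

theorem exists_comparable_sphere [T2Space B] [MeasurableSpace X] [BorelSpace X] [BorelSpace B]
    (hκ : Continuous κ)
    (hfib : ∀ a b, κ a = κ b → ∀ p q, |a.1 p q - b.1 p q| ≤ c) (hv : 0 ≤ v) (hC : 1 ≤ C)
    (hμ : IsQuasiconformalDensity (fun z => κ (HoroBord.incl z)) act Λ v C μ)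
    [IsProbabilityMeasure (μ o)] {I : Set ℝ} (hI : ¬ BddAbove I) {m : ℝ → Measure X}
    (hm : AreSphereMeasures o I m) {D : ℝ} (hD : 1 ≤ D)
    (hW : WeakLimitsComparable (fun z => κ (HoroBord.incl z)) Λ (μ o) I m D) {K : ℝ≥0}
    (hK : ∀ r ∈ I, ∀ t ∈ I, t < r → Comparable K (∫⁻ x, expDist G v o t x ∂(m t))
      (∫⁻ x, horoMax G v o t (HoroBord.incl x) ∂(m r))) :
    ∀ t ∈ I, Comparable (K * ((C * Real.exp (v * c)).toNNReal * D.toNNReal))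
      (∫⁻ x in Metric.sphere o t, expDist G v o t x ∂(m t)) (extremalCocycle G Λ v μ o t) := by
  obtain ⟨ν, r, hν, hrI, hr, hlim⟩ := exists_weak_limit hI hm
  have hmapν : IsProbabilityMeasure (ν.map κ) :=
    Measure.isProbabilityMeasure_map hκ.measurable.aemeasurable
  obtain ⟨-, hdens⟩ := hW (ν.map κ) inferInstance
    (IsWeakLimit.map hκ ⟨r, hrI, hr, hlim⟩)
  intro t ht
  rw [restrict_eq_self_of_measure_compl (hm t ht).2]
  have h1 : Comparable K (∫⁻ x, expDist G v o t x ∂(m t)) (∫⁻ h, horoMax G v o t h ∂ν) := by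
    refine Comparable.of_tendsto (u := fun n => ∫⁻ x, horoMax G v o t (HoroBord.incl x) ∂(m (r n)))
      ?_ ((hr.eventually_gt_atTop t).mono fun n hn => hK (r n) (hrI n) t ht hn)
    rw [lintegral_horoMax_eq ν hv (φ := fun h => h) measurable_id]
    have hcont : Continuous fun h => (horoMax G v o t h).toReal :=
      ENNReal.continuousOn_toReal.comp_continuous (continuous_horoMax G v o t) fun h =>
        ((horoMax_le_one G o hv h).trans_lt ENNReal.one_lt_top).ne
    refine ((ENNReal.continuous_ofReal.tendsto _).comp
      (hlim (BoundedContinuousFunction.mkOfCompact ⟨_, hcont⟩))).congr fun n => ?_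
    have := (hm (r n) (hrI n)).1
    rw [lintegral_horoMax_eq _ hv HoroBord.continuous_incl.measurable]
    rfl
  have h2 : Comparable (C * Real.exp (v * c)).toNNReal (∫⁻ h, horoMax G v o t h ∂ν)
      ((∫⁻ ξ, maxDeriv G μ o t ξ ∂(ν.map κ)) / ENNReal.ofReal (Real.exp (v * t))) := by
    have hmeas : Measurable fun h => maxDeriv G μ o t (κ h) :=
      measurable_maxDeriv.comp hκ.measurable
    rw [lintegral_map measurable_maxDeriv hκ.measurable, div_eq_mul_inv,
      ← lintegral_mul_const _ hmeas]
    refine Comparable.lintegral ?_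
    have hae := hdens.1.ae_le (comparable_maxDeriv_horoMax (t := t) (o := o) hκ hfib hv hC hμ)
    filter_upwards [ae_of_ae_map hκ.measurable.aemeasurable hae] with h hh
    exact (hh h rfl).symm
  have h3 := (hdens.comparable_lintegral hD (maxDeriv G μ o t)).div
    (ENNReal.ofReal (Real.exp (v * t)))
  rw [extremalCocycle, restrict_eq_self_of_measure_compl (hμ.carried o)]
  exact h1.trans (h2.trans h3)

end Cocycle

/-! ### Averaging measures -/

theorem IsGeodesicSpace.radialPoints_nonempty {X : Type*} [MetricSpace X]
    (hX : IsGeodesicSpace X) {o : X} {t : ℝ} {x : X} (ht : 0 ≤ t)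
    (hx : t ≤ dist o x) : (radialPoints o t x).Nonempty := by
  obtain ⟨y, h1, h2⟩ := hX.exists_dist_eq o x ht hx
  exact ⟨y, h1, by rw [h1, h2]; ring⟩

section Averaging

variable {G X : Type*} [MetricSpace X] [ProperSpace X] [Group G] [MulAction G X]
  [ProperlyDiscontinuousSMul G X] {v δ r t : ℝ} {o : X}

theorem comparable_expDist_of_mem_radialPoints (hδ : IsHyperbolicWith X δ) (hv : 0 ≤ v)
    {x y : X} (hy : y ∈ radialPoints o t x) :
    Comparable (Real.exp (v * (4 * δ))).toNNReal (expDist G v o t y)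
      (horoMax G v o t (HoroBord.incl x)) := by
  refine comparable_expDist_horoMax G hδ hv hy.1 ?_
  have h1 := hy.1
  have h2 := hy.2
  simp only [HoroBord.incl, distCocycle]
  linarith

variable [MeasurableSpace X] [BorelSpace X]

theorem comparable_of_map_radialProj (hX : IsGeodesicSpace X) (hδ : IsHyperbolicWith X δ)
    (hv : 0 ≤ v) (ht : 0 ≤ t) (htr : t < r) {ν ν' : Measure X} [IsProbabilityMeasure ν']
    (hν : ν (Metric.sphere o r)ᶜ = 0) (h : ν.map (radialProj o t) = ν') :
    Comparable (Real.exp (v * (4 * δ))).toNNReal (∫⁻ x, expDist G v o t x ∂ν')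
      (∫⁻ x, horoMax G v o t (HoroBord.incl x) ∂ν) := by
  have hae : AEMeasurable (radialProj o t) ν := by
    by_contra hn
    rw [Measure.map_of_not_aemeasurable hn] at h
    exact IsProbabilityMeasure.ne_zero ν' h.symm
  rw [← h, lintegral_map' (continuous_expDist G v o t).measurable.aemeasurable hae]
  refine Comparable.lintegral ?_
  filter_upwards [ae_mem_of_measure_compl hν] with x hx
  have hx' : dist o x = r := by rw [dist_comm]; exact hx
  have hne := hX.radialPoints_nonempty ht (htr.le.trans_eq hx'.symm)
  refine comparable_expDist_of_mem_radialPoints hδ hv ?_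
  rw [radialProj, dif_pos hne]
  exact hne.some_mem

theorem comparable_of_coarsePush (hX : IsGeodesicSpace X) (hδ : IsHyperbolicWith X δ)
    (hfin : ∀ x, (radialPoints o t x).Finite)
    (hv : 0 ≤ v) (ht : 0 ≤ t) (htr : t < r) {ν ν' : Measure X} [IsProbabilityMeasure ν']
    (hν : ν (Metric.sphere o r)ᶜ = 0) {D : ℝ} (hD : 1 ≤ D)
    (h : DensityBounds (coarsePush o t ν) ν' D fun _ => 1) :
    Comparable (D.toNNReal * (Real.exp (v * (4 * δ))).toNNReal) (∫⁻ x, expDist G v o t x ∂ν')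
      (∫⁻ x, horoMax G v o t (HoroBord.incl x) ∂ν) := by
  refine (h.comparable_lintegral hD _).symm.trans ?_
  have hae : AEMeasurable (fun x => ProbabilityTheory.uniformOn (radialPoints o t x)) ν := by
    by_contra hn
    have h0 : coarsePush o t ν = 0 := by
      rw [coarsePush, Measure.bind, Measure.map_of_not_aemeasurable hn, Measure.join_zero]
    have := (h.measure_le hD).2
    rw [h0, smul_zero] at this
    exact IsProbabilityMeasure.ne_zero ν' (le_antisymm this (Measure.zero_le _))
  rw [coarsePush, Measure.lintegral_bind hae (continuous_expDist G v o t).measurable.aemeasurable]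
  refine Comparable.lintegral ?_
  filter_upwards [ae_mem_of_measure_compl hν] with x hx
  have hx' : dist o x = r := by rw [dist_comm]; exact hx
  have hne := hX.radialPoints_nonempty ht (htr.le.trans_eq hx'.symm)
  have := ProbabilityTheory.isProbabilityMeasure_uniformOn (hfin x) hne
  have hmem : ∀ᵐ y ∂(ProbabilityTheory.uniformOn (radialPoints o t x)), y ∈ radialPoints o t x :=
    ProbabilityTheory.ae_cond_mem (hfin x).measurableSet
  have := Comparable.lintegral (hmem.mono fun y hy =>
    comparable_expDist_of_mem_radialPoints (G := G) hδ hv hy)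
  simpa using this

end Averaging

theorem IsUnitGraph.finite_radialPoints {X : Type*} [MetricSpace X] {V : Set X}
    {Γ : SimpleGraph V} (hΓ : IsUnitGraph X V Γ)
    (hV : ∀ R : ℝ, ∃ N : ℕ, ∀ x : X, (V ∩ Metric.closedBall x R).encard ≤ N) (o : X) (t : ℝ)
    (x : X) : (radialPoints o t x).Finite := by
  obtain ⟨N, hN⟩ := hV (t + 1)
  have hfin : (V ∩ Metric.closedBall o (t + 1)).Finite :=
    finite_of_encard_le_coe (hN o)
  obtain ⟨u₀, v₀, hadj₀, ho⟩ := hΓ.exists_edge o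
  set W : Set V := (↑) ⁻¹' (V ∩ Metric.closedBall o (t + 1)) with hW
  have hWfin : W.Finite := hfin.preimage Subtype.val_injective.injOn
  have hedge : ∀ u w : V, Γ.Adj u w →
      {y : X | dist (u : X) y + dist y (w : X) = 1 ∧ dist o y = t}.Finite := by
    intro u w huw
    have hinj : InjOn (fun y : X => dist (u : X) y)
        {y : X | dist (u : X) y + dist y (w : X) = 1 ∧ dist o y = t} := by
      intro y hy z hz hyz
      have := hΓ.dist_same_edge u w y z huw hy.1 hz.1
      rw [show dist (u : X) y = dist (u : X) z from hyz, sub_self, abs_zero] at this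
      exact dist_eq_zero.1 this
    refine Set.Finite.of_finite_image ?_ hinj
    by_cases hs : s(u₀, v₀) = s(u, w)
    · have ho' : dist (u : X) o + dist o (w : X) = 1 := by
        rcases Sym2.eq_iff.1 hs with ⟨rfl, rfl⟩ | ⟨rfl, rfl⟩
        · exact ho
        · linarith [dist_comm (v₀ : X) o, dist_comm o (u₀ : X)]
      refine (Set.toFinite {dist (u : X) o - t, dist (u : X) o + t}).subset ?_
      rintro _ ⟨y, hy, rfl⟩
      have := hΓ.dist_same_edge u w o y huw ho' hy.1
      rw [hy.2] at this
      rcases abs_choice (dist (u : X) o - dist (u : X) y) with h | h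
      · left; linarith
      · right; change _ = _; linarith
    · let E : V → V → ℝ := fun a b => t - dist o (a : X) - dist (a : X) (b : X)
      refine (Set.toFinite {E u₀ u, E v₀ u, 1 - E u₀ w, 1 - E v₀ w}).subset ?_
      rintro _ ⟨y, hy, rfl⟩
      obtain ⟨a, b, ha, hb, hd⟩ := hΓ.dist_other_edge u₀ v₀ u w o y hadj₀ huw hs ho hy.1
      have hy1 := hy.1
      have hy2 := hy.2
      have hc := dist_comm y (w : X)
      rcases ha with rfl | rfl <;> rcases hb with rfl | rfl <;>
        simp only [E, mem_insert_iff, mem_singleton_iff]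
      · left; linarith
      · right; right; left; linarith
      · right; left; linarith
      · right; right; right; linarith
  refine ((hWfin.prod hWfin).biUnion (t := fun e : V × V =>
    {y : X | Γ.Adj e.1 e.2 ∧ dist (e.1 : X) y + dist y (e.2 : X) = 1 ∧ dist o y = t})
    fun e _ => ?_).subset ?_
  · by_cases he : Γ.Adj e.1 e.2
    · exact (hedge _ _ he).subset fun y hy => hy.2
    · exact Set.finite_empty.subset fun y hy => he hy.1
  · intro y hy
    obtain ⟨u, w, huw, he⟩ := hΓ.exists_edge y
    have h1 : dist o y = t := hy.1
    have hu : u ∈ W := ⟨u.2, by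
      rw [Metric.mem_closedBall, dist_comm]
      linarith [dist_triangle o y u, dist_comm y (u : X), dist_nonneg (x := y) (y := (w : X))]⟩
    have hw : w ∈ W := ⟨w.2, by
      rw [Metric.mem_closedBall, dist_comm]
      linarith [dist_triangle o y w, dist_nonneg (x := (u : X)) (y := y)]⟩
    exact mem_iUnion₂.2 ⟨(u, w), ⟨hu, hw⟩, huw, he, h1⟩

end ECG

end

theorem proposition4p11 {X G : Type*} [MetricSpace X] [ProperSpace X] [MeasurableSpace X]
    [BorelSpace X] [Group G] [MulAction G X] [IsIsometricSMul G X] [ProperlyDiscontinuousSMul G X]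
    (hfree : ∀ (g : G) (x : X), g • x = x → g = 1)
    (o : X) (v : ℝ) (hv : 0 ≤ v) (C : ℝ) (hC : 1 ≤ C)
    (I : Set ℝ) (hI : I ⊆ Set.Ici 0) (hI' : ¬ BddAbove I) :
    -- CAT(-1) spaces, with the horofunction boundary
    (ECG.IsCATNegOne X →
      ∀ Λ : Set (ECG.HoroBord X), Λ = ECG.limitSet G ECG.HoroBord.incl o → Λ.Infinite →
      ∀ μ : X → MeasureTheory.Measure (ECG.HoroBord X),
        ECG.IsQuasiconformalDensity (G := G) ECG.HoroBord.incl ECG.HoroBord.act Λ v C μ →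
        MeasureTheory.IsProbabilityMeasure (μ o) →
      ∀ m : ℝ → MeasureTheory.Measure X,
        ECG.IsAveraging ECG.HoroBord.incl Λ (μ o) o I m →
      ∃ (K : NNReal) (R₀ : ℝ), ∀ r ≥ R₀, ∀ π : ECG.HoroBord X → X,
        ECG.IsBoundaryProj ECG.HoroBord.incl Λ o r π →
        ECG.Comparable K (ECG.extremalCocycle G Λ v μ o r)
          (∫⁻ ξ in Λ, ECG.expDist G v o r (π ξ) ∂(μ o)) ∧
        (r ∈ I → ECG.Comparable K (∫⁻ ξ in Λ, ECG.expDist G v o r (π ξ) ∂(μ o))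
          (∫⁻ x in Metric.sphere o r, ECG.expDist G v o r x ∂(m r)))) ∧
    -- Gromov-hyperbolic spaces, with the Gromov boundary
    (ECG.IsGeodesicSpace X → ECG.IsGromovHyperbolic X →
      ∀ Λ : Set (ECG.GromovBord X), Λ = ECG.limitSet G ECG.GromovBord.incl o → Λ.Infinite →
      ∀ μ : X → MeasureTheory.Measure (ECG.GromovBord X),
        ECG.IsQuasiconformalDensity (G := G) ECG.GromovBord.incl ECG.GromovBord.act Λ v C μ →
        MeasureTheory.IsProbabilityMeasure (μ o) →
      (∃ (K : NNReal) (R₀ : ℝ), ∀ r ≥ R₀, ∀ π : ECG.GromovBord X → X,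
        ECG.IsBoundaryProj ECG.GromovBord.incl Λ o r π →
        ECG.Comparable K (ECG.extremalCocycle G Λ v μ o r)
          (∫⁻ ξ in Λ, ECG.expDist G v o r (π ξ) ∂(μ o))) ∧
      (ECG.IsUniformlyProperUnitGraph X →
        ∀ m : ℝ → MeasureTheory.Measure X,
          ECG.IsCoarselyAveraging ECG.GromovBord.incl Λ (μ o) o I m →
        ∃ (K : NNReal) (R₀ : ℝ), ∀ r ≥ R₀, r ∈ I → ∀ π : ECG.GromovBord X → X,
          ECG.IsBoundaryProj ECG.GromovBord.incl Λ o r π →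
          ECG.Comparable K (∫⁻ ξ in Λ, ECG.expDist G v o r (π ξ) ∂(μ o))
            (∫⁻ x in Metric.sphere o r, ECG.expDist G v o r x ∂(m r)))) := by

  constructor
  · intro hcat Λ _ _ μ hμ hprob m ⟨hm, hpush, D, hD, hW⟩
    obtain ⟨δ, hδ⟩ := hcat.isGromovHyperbolic
    have hκ : Continuous fun h : ECG.HoroBord X => h := continuous_id
    have hfib : ∀ a b : ECG.HoroBord X, a = b → ∀ p q, |a.1 p q - b.1 p q| ≤ (0 : ℝ) := by
      rintro a _ rfl p q; simp
    have h2 := ECG.exists_comparable_sphere (K := (Real.exp (v * (4 * δ))).toNNReal) hκ hfib hv hC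
      hμ hI' hm hD hW fun r hr t ht htr =>
        have := (hm t ht).1
        ECG.comparable_of_map_radialProj hcat.1 hδ hv (hI ht) htr (hm r hr).2 (hpush r hr t ht htr)
    have h1 := fun r hr π hπ => ECG.comparable_extremalCocycle (o := o) (t := r) (π := π)
      hκ hfib hv hC hμ hδ hr hπ
    refine ⟨max _ _, 0, fun r hr π hπ => ⟨(h1 r hr π hπ).mono (le_max_left _ _), fun hrI =>
      (((h2 r hrI).trans (h1 r hr π hπ)).symm).mono (le_max_right _ _)⟩⟩
  · rintro hX ⟨δ, hδ⟩ Λ _ _ μ hμ hprob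
    have hT2 := ECG.GromovBord.t2Space hδ hX
    have hκ := ECG.HoroBord.continuous_toGromovBord (X := X)
    have hfib : ∀ a b : ECG.HoroBord X, a.toGromovBord = b.toGromovBord →
        ∀ p q, |a.1 p q - b.1 p q| ≤ 8 * δ :=
      fun a b hab => ECG.HoroBord.abs_sub_le_of_toGromovBord_eq hδ hX hab
    have h1 := fun r hr π hπ => ECG.comparable_extremalCocycle (o := o) (t := r) (π := π)
      hκ hfib hv hC hμ hδ hr hπ
    refine ⟨⟨_, 0, h1⟩, ?_⟩
    rintro ⟨V, Γ, hΓ, hV⟩ m ⟨hm, D, hD, hpush, hW⟩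
    have h2 := ECG.exists_comparable_sphere
      (K := D.toNNReal * (Real.exp (v * (4 * δ))).toNNReal) hκ hfib hv hC
      hμ hI' hm hD hW fun r hr t ht htr =>
        have := (hm t ht).1
        ECG.comparable_of_coarsePush hX hδ (hΓ.finite_radialPoints hV o t) hv (hI ht) htr
          (hm r hr).2 hD (hpush r hr t ht htr)
    exact ⟨_, 0, fun r hr hrI π hπ => ((h2 r hrI).trans (h1 r hr π hπ)).symm⟩
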